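/- **Setting.** For $n\ge 1$ let $\Theta=(\rho,\theta,\alpha_1,\dots,\alpha_n,\beta_1,\dots,\beta_n)\in\mathbb R^{2n+2}$ with $\sum_i\alpha_i=\sum_j\beta_j=0$. The random directed graph $X=(X_{ij})_{i,j\in[n]}$, with $X_{ij}\in\{0,1\}$ and $X_{ii}=0$, follows the $p_1$ model with parameter $\Theta$ if the dyads $D_{ij}=(X_{ij},X_{ji})$, $i<j$, are independent and, for $a,b\in\{0,1\}$, $$p_{ij}^{ab}:=\mathbb P(D_{ij}=(a,b))=\frac{1}{k_{ij}}\exp\{a(\theta+\alpha_i+\beta_j)+b(\theta+\alpha_j+\beta_i)+ab\rho\},$$ where $k_{ij}$ is the normalizing constant. For $i\ne j$ let $I_{ij}^{ab}$ be the indicator of $D_{ij}=(a,b)$. For nodes $s,t$ (possibly $s=t$) and $d,e\in\{0,1\}^2$ put $$S^{d,e}_{s,t}=\sum_{k\ne l;\;k,l\notin\{s,t\}} I_{ks}^{d}I_{kl}^{e}I_{tl}^{d},\qquad R_{s,t}=\log\frac{S^{01,00}_{s,t}}{S^{00,01}_{s,t}},\qquad R'_t=\log\frac{S^{11,10}_{t,t}}{S^{10,11}_{t,t}}.$$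 The triple-dyad ratio estimator $\widehat\Theta=(\hat\rho,\hat\theta,\hat\alpha_1,\dots,\hat\alpha_n,\hat\beta_1,\dots,\hat\beta_n)$ is $$\hat\theta=\frac1n\sum_t R_{t,t},\qquad \hat\rho=\frac1n\sum_t R'_t-\hat\theta,\qquad \hat\alpha_i=\frac1n\sum_t R_{i,t}-\hat\theta,\qquad \hat\beta_j=\frac1n\sum_t R_{t,j}-\hat\theta ;$$ it is well defined when all the numerators and denominators occurring here are positive. **Theorem 1.** (1) For every $C>0$ there is a constant $M>0$, depending only on $C$, such that for all $n\ge 1$ and all $\Theta$ as above with $\|\Theta\|_\infty\le C$, with probability at least $1-M/n$ the estimator is well defined and $$\|\widehat\Theta-\Theta\|_\infty\le M\sqrt{\frac{\log n}{n}} .$$ (2) Let $\Theta=\Theta_n$ be a sequence of parameters as above and put $C_n=\max_{i\ne j}p_{ij}^{10}$, $c_n=\min_{i\ne j}p_{ij}^{10}$. Suppose that, as $n\to\infty$, $$\theta\to-\infty,\qquad |\rho|\ll|\theta|,$$ that, for some constant $K>0$, $p_{ij}^{11}\le K e^{\rho}C_n^2$ for all $i\ne j$ and all large $n$, and that $$\frac{e^{\rho}c_n^{10}}{C_n^8}\gg\frac{\log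 n}{n},\qquad \frac{e^{2\rho}c_n^{10}}{C_n^5}\gg\frac{\log n}{n^2},\qquad \frac{e^{3\rho/2}c_n^{19/2}}{C_n^{25/4}}\gg\frac{(\log n)^{3/4}}{n}.$$ Then there is a constant $M>0$, depending only on $K$, such that for all sufficiently large $n$, with probability at least $1-M/n$, the estimator is well defined, $$|\hat\rho-\rho|\le M\left(\sqrt{\frac{C_n^5\log n}{e^{2\rho}n^2c_n^{10}}}+\sqrt{\frac{C_n^8\log n}{e^{\rho}n\,c_n^{10}}}\right)$$ and $$\max\Big\{\max_{i}|\hat\alpha_i-\alpha_i|,\ \max_{j}|\hat\beta_j-\beta_j|,\ |\hat\theta-\theta|\Big\}\le M\sqrt{\frac{C_n^3\log n}{n\,c_n^4}} .$$ -/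

import Mathlib

open Filter Asymptotics MeasureTheory ProbabilityTheory

namespace P1

/-- Parameter vectors `Θ = (ρ, θ, α₁, …, αₙ, β₁, …, βₙ)` of the `p₁` model on `n` nodes.
The norm which Mathlib puts on this product is the `ℓ∞` norm on the `2n + 2` coordinates. -/
abbrev Param (n : ℕ) : Type := ℝ × ℝ × (Fin n → ℝ) × (Fin n → ℝ)

namespace Param

variable {n : ℕ}

/-- reciprocity parameter `ρ` -/
def rho (Θ : Param n) : ℝ := Θ.1

/-- density parameter `θ` -/
def theta (Θ : Param n) : ℝ := Θ.2.1

/-- expansiveness parameters `αᵢ` -/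
def alpha (Θ : Param n) (i : Fin n) : ℝ := Θ.2.2.1 i

/-- popularity parameters `βⱼ` -/
def beta (Θ : Param n) (j : Fin n) : ℝ := Θ.2.2.2 j

/-- The identification constraints `∑ αᵢ = 0` and `∑ βⱼ = 0`. -/
def Identified (Θ : Param n) : Prop := ∑ i, Θ.alpha i = 0 ∧ ∑ j, Θ.beta j = 0

/-- The normalizing constant `k_ij`. -/
noncomputable def k (Θ : Param n) (i j : Fin n) : ℝ :=
  1 + Real.exp (Θ.theta + Θ.alpha i + Θ.beta j) + Real.exp (Θ.theta + Θ.alpha j + Θ.beta i)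
    + Real.exp (Θ.rho + 2 * Θ.theta + Θ.alpha i + Θ.alpha j + Θ.beta i + Θ.beta j)

/-- The dyad probability `p_ij^{ab}`. -/
noncomputable def p (Θ : Param n) (a b : Fin 2) (i j : Fin n) : ℝ :=
  Real.exp (((a : ℕ) : ℝ) * (Θ.theta + Θ.alpha i + Θ.beta j)
      + ((b : ℕ) : ℝ) * (Θ.theta + Θ.alpha j + Θ.beta i)
      + ((a : ℕ) : ℝ) * ((b : ℕ) : ℝ) * Θ.rho) / Θ.k i j

/-- `C_n = max_{i ≠ j} p_ij^{10}` -/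
noncomputable def maxAsym (Θ : Param n) : ℝ :=
  ⨆ e : {e : Fin n × Fin n // e.1 ≠ e.2}, Θ.p 1 0 e.1.1 e.1.2

/-- `c_n = min_{i ≠ j} p_ij^{10}` -/
noncomputable def minAsym (Θ : Param n) : ℝ :=
  ⨅ e : {e : Fin n × Fin n // e.1 ≠ e.2}, Θ.p 1 0 e.1.1 e.1.2

end Param

/-- `X` is the adjacency matrix of a random directed graph on `n` nodes that follows the `p₁` model
with parameter `Θ`: no self-loops, mutually independent dyads `D_ij = (X_ij, X_ji)`, `i < j`, and
`ℙ(D_ij = (a, b)) = p_ij^{ab}`. -/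
structure IsModel {n : ℕ} (Θ : Param n) {Ω : Type*} [MeasurableSpace Ω] (P : Measure Ω)
    (X : Ω → Fin n → Fin n → Fin 2) : Prop where
  measurable : ∀ i j, Measurable fun ω => X ω i j
  loopless : ∀ ω i, X ω i i = 0
  indep : iIndepFun
    (fun (e : {e : Fin n × Fin n // e.1 < e.2}) ω => (X ω e.1.1 e.1.2, X ω e.1.2 e.1.1)) P
  law : ∀ i j, i < j → ∀ a b : Fin 2, P.real {ω | X ω i j = a ∧ X ω j i = b} = Θ.p a b i j

section Estimator

variable {n : ℕ} (x : Fin n → Fin n → Fin 2)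

/-- The dyad indicator `I_ij^{ab}` of the adjacency matrix `x`, with `d = (a, b)`. -/
noncomputable def dyadInd (d : Fin 2 × Fin 2) (i j : Fin n) : ℝ :=
  if (x i j, x j i) = d then 1 else 0

/-- The triple-dyad sum `∑ I_{ks}^d I_{kl}^e I_{tl}^d` over all ordered pairs `(k, l)` of distinct
nodes, both different from `s` and from `t` (where `s = t` is allowed). -/
noncomputable def tripleSum (d e : Fin 2 × Fin 2) (s t : Fin n) : ℝ :=
  ∑ k, ∑ l, if k ≠ l ∧ k ≠ s ∧ k ≠ t ∧ l ≠ s ∧ l ≠ t then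
    dyadInd x d k s * dyadInd x e k l * dyadInd x d t l else 0

/-- The log ratio whose population version is `θ + α_s + β_t`. -/
noncomputable def logRatio (s t : Fin n) : ℝ :=
  Real.log (tripleSum x (0, 1) (0, 0) s t / tripleSum x (0, 0) (0, 1) s t)

/-- The log ratio whose population version is `ρ + θ + α_t + β_t`. -/
noncomputable def logRatioRec (t : Fin n) : ℝ :=
  Real.log (tripleSum x (1, 1) (1, 0) t t / tripleSum x (1, 0) (1, 1) t t)

/-- `θ̂` -/
noncomputable def thetaHat : ℝ := (1 / (n : ℝ)) * ∑ t, logRatio x t t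

/-- `ρ̂` -/
noncomputable def rhoHat : ℝ := (1 / (n : ℝ)) * ∑ t, logRatioRec x t - thetaHat x

/-- `α̂ᵢ` -/
noncomputable def alphaHat (i : Fin n) : ℝ := (1 / (n : ℝ)) * ∑ t, logRatio x i t - thetaHat x

/-- `β̂ⱼ` -/
noncomputable def betaHat (j : Fin n) : ℝ := (1 / (n : ℝ)) * ∑ t, logRatio x t j - thetaHat x

/-- The triple-dyad ratio estimator `Θ̂ = (ρ̂, θ̂, α̂₁, …, α̂ₙ, β̂₁, …, β̂ₙ)`. -/
noncomputable def estimator : Param n := (rhoHat x, thetaHat x, alphaHat x, betaHat x)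

/-- All numerators and denominators in the estimator are positive, so that every quotient and every
logarithm in it is a genuine one. -/
def WellDefined : Prop :=
  (∀ s t, 0 < tripleSum x (0, 1) (0, 0) s t ∧ 0 < tripleSum x (0, 0) (0, 1) s t) ∧
  (∀ t, 0 < tripleSum x (1, 1) (1, 0) t t ∧ 0 < tripleSum x (1, 0) (1, 1) t t)

end Estimator

/-- The bound for `ρ̂ - ρ` in the sparse regime, up to a constant factor. -/
noncomputable def rhoRate {n : ℕ} (Θ : Param n) : ℝ :=
  Real.sqrt (Θ.maxAsym ^ 5 * Real.log n
      / (Real.exp (2 * Θ.rho) * (n : ℝ) ^ 2 * Θ.minAsym ^ 10))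
    + Real.sqrt (Θ.maxAsym ^ 8 * Real.log n / (Real.exp Θ.rho * n * Θ.minAsym ^ 10))

/-- The common bound for `θ̂`, `α̂ᵢ`, `β̂ⱼ` in the sparse regime, up to a constant factor. -/
noncomputable def mainRate {n : ℕ} (Θ : Param n) : ℝ :=
  Real.sqrt (Θ.maxAsym ^ 3 * Real.log n / (n * Θ.minAsym ^ 4))

/-- The sparse regime for a sequence of parameters: `θ → -∞`, `|ρ| ≪ |θ|`, the three growth
conditions on `C_n` and `c_n`, and `p_ij^{11} ≤ K e^ρ C_n²` for all `i ≠ j` and large `n`. -/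
structure SparseRegime (K : ℝ) (Θ : ∀ n : ℕ, Param n) : Prop where
  theta_atBot : Tendsto (fun n => (Θ n).theta) atTop atBot
  rho_small : (fun n => (Θ n).rho) =o[atTop] fun n => (Θ n).theta
  mutual_le : ∀ᶠ n in atTop, ∀ i j : Fin n, i ≠ j →
    (Θ n).p 1 1 i j ≤ K * (Real.exp (Θ n).rho * (Θ n).maxAsym ^ 2)
  growth_one : (fun n : ℕ => Real.log n / n) =o[atTop] fun n =>
    Real.exp (Θ n).rho * (Θ n).minAsym ^ 10 / (Θ n).maxAsym ^ 8
  growth_two : (fun n : ℕ => Real.log n / (n : ℝ) ^ 2) =o[atTop] fun n =>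
    Real.exp (2 * (Θ n).rho) * (Θ n).minAsym ^ 10 / (Θ n).maxAsym ^ 5
  growth_three : (fun n : ℕ => Real.log n ^ (3 / 4 : ℝ) / n) =o[atTop] fun n =>
    Real.exp (3 * (Θ n).rho / 2) * (Θ n).minAsym ^ (19 / 2 : ℝ) / (Θ n).maxAsym ^ (25 / 4 : ℝ)

end P1

/-! In the two sums of a log ratio, the terms of a given pair (k, l) involve the same three dyads
{k,s}, {k,l}, {t,l}. Their normalizing constants therefore cancel term by term, and so do the
parameters of k and l. Hence the ratio of the two expectations is exactly exp(θ + α_s + β_t)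
(`popTriple_ratio`), respectively exp(ρ + θ + α_t + β_t) (`popTriple_ratio_rec`). Averaging over
nodes and using the identification constraints isolates each parameter (`estimator_error`), so it
remains to show that every triple-dyad sum is close to its expectation in relative error.

The terms of such a sum are dependent, but the sum is linear in each of its three dyads, and it is
averaged in layers. Given the dyads at s and t, it is a weighted sum of independent dyads with mean
`condTriple`. This mean is a sum over k of `condInner` times the indicator at {k,s}. For each k,
`condInner` is a weighted sum over the dyads at t, close to the constant `popInner`; with these
constants inserted, the sum over the dyads at s is close to `popTriple`. Each layer is one
application of `weighted_chernoff`, and since all errors are relative and all indicators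
nonnegative, they compose without further independence, even for s = t. The result is
`IsModel.tripleSum_concentration`.

`Resolves` lists what these bounds need: `degree` serves the two layers at s and t, `triangle` the
layer of the pairs (k, l). With L = 4 log n, a union bound over s, t and four types of sum gives
`IsModel.estimator_concentration`. The two halves of the theorem differ only in how `Resolves` is
verified: from a uniform lower bound on all dyad probabilities, or from powers of c_n, C_n and e^ρ.
-/

namespace P1

/-! ### Chernoff bounds and conditioning on an independent part -/

section Chernoff

variable {Ω : Type*} [mΩ : MeasurableSpace Ω] {P : Measure Ω} [IsProbabilityMeasure P]

/-- A random variable with values in `[0, W]` has a Poisson-like moment generating function. -/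
lemma mgf_le_of_mem_Icc {Z : Ω → ℝ} (hZ : Measurable Z) {W : ℝ}
    (h0 : ∀ ω, 0 ≤ Z ω) (hW : ∀ ω, Z ω ≤ W) {t : ℝ} (ht : |t| * W ≤ 1) :
    mgf Z P t ≤ Real.exp ((t + t ^ 2 * W) * ∫ ω, Z ω ∂P) := by
  have hint : Integrable Z P := Integrable.of_mem_Icc 0 W hZ.aemeasurable
    (ae_of_all _ fun ω => ⟨h0 ω, hW ω⟩)
  have hpt : ∀ ω, Real.exp (t * Z ω) ≤ 1 + (t + t ^ 2 * W) * Z ω := by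
    intro ω
    have h1 : |t * Z ω| ≤ 1 := by
      rw [abs_mul, abs_of_nonneg (h0 ω)]
      exact (mul_le_mul_of_nonneg_left (hW ω) (abs_nonneg t)).trans ht
    have h2 := (abs_le.1 (Real.abs_exp_sub_one_sub_id_le h1)).2
    have h3 : (t * Z ω) ^ 2 ≤ t ^ 2 * W * Z ω := by
      nlinarith [mul_nonneg (sq_nonneg t) (mul_nonneg (h0 ω) (sub_nonneg.2 (hW ω)))]
    linarith
  have hb : Integrable (fun ω => 1 + (t + t ^ 2 * W) * Z ω) P :=
    (integrable_const 1).add (hint.const_mul _)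
  calc mgf Z P t = ∫ ω, Real.exp (t * Z ω) ∂P := rfl
    _ ≤ ∫ ω, (1 + (t + t ^ 2 * W) * Z ω) ∂P :=
        integral_mono_of_nonneg (ae_of_all _ fun ω => (Real.exp_pos _).le) hb (ae_of_all _ hpt)
    _ = (t + t ^ 2 * W) * ∫ ω, Z ω ∂P + 1 := by
        rw [integral_add (integrable_const 1) (hint.const_mul _), integral_const_mul]
        simp [add_comm]
    _ ≤ _ := Real.add_one_le_exp _

/-- Multiplicative Chernoff bound for sums of independent `[0, W]`-valued random variables. -/
lemma chernoff {ι : Type*} [Fintype ι] {Z : ι → Ω → ℝ} (hind : iIndepFun Z P)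
    (hZ : ∀ i, Measurable (Z i)) {W : ℝ} (hWpos : 0 < W)
    (h0 : ∀ i ω, 0 ≤ Z i ω) (hW : ∀ i ω, Z i ω ≤ W) {μ : ℝ} (hμ : μ = ∑ i, ∫ ω, Z i ω ∂P)
    {ε L : ℝ} (hε0 : 0 ≤ ε) (hε1 : ε ≤ 1) (hL : 4 * W * L ≤ ε ^ 2 * μ) :
    P.real {ω | ¬ |∑ i, Z i ω - μ| ≤ ε * μ} ≤ 2 * Real.exp (-L) := by
  have hmgf : ∀ t : ℝ, |t| * W ≤ 1 →
      mgf (fun ω => ∑ i, Z i ω) P t ≤ Real.exp ((t + t ^ 2 * W) * μ) := by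
    intro t ht
    have := hind.mgf_sum (t := t) hZ Finset.univ
    have h2 : (∑ i, Z i) = fun ω => ∑ i, Z i ω := by ext; simp
    rw [h2] at this
    rw [this, hμ, Finset.mul_sum, Real.exp_sum]
    exact Finset.prod_le_prod (fun i _ => mgf_nonneg) fun i _ =>
      mgf_le_of_mem_Icc (hZ i) (h0 i) (hW i) ht
  have hmeas : Measurable fun ω => ∑ i, Z i ω := Finset.measurable_sum _ fun i _ => hZ i
  have hint : ∀ t : ℝ, Integrable (fun ω => Real.exp (t * ∑ i, Z i ω)) P := by
    intro t
    refine Integrable.of_mem_Icc 0 (Real.exp (|t| * ∑ _i : ι, W))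
      (Real.measurable_exp.comp (hmeas.const_mul t)).aemeasurable (ae_of_all _ fun ω => ?_)
    refine ⟨(Real.exp_pos _).le, Real.exp_le_exp.2 ?_⟩
    refine (le_abs_self _).trans ?_
    rw [abs_mul, abs_of_nonneg (Finset.sum_nonneg fun i _ => h0 i ω)]
    exact mul_le_mul_of_nonneg_left (Finset.sum_le_sum fun i _ => hW i ω) (abs_nonneg t)
  -- This minimizes the exponent -lam ε μ + lam² W μ; the minimum is -ε² μ / (4W), at most -L by
  -- `hL`.
  set lam : ℝ := ε / (2 * W) with hlam
  have hlam0 : 0 ≤ lam := by positivity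
  have hlamW : lam * W = ε / 2 := by rw [hlam]; field_simp
  have hone : |lam| * W ≤ 1 := by rw [abs_of_nonneg hlam0, hlamW]; linarith
  have hexp : L ≤ lam * ε * μ / 2 := by
    have : lam * ε * μ / 2 = ε ^ 2 * μ / (4 * W) := by rw [hlam]; field_simp; ring
    rw [this, le_div_iff₀ (by positivity)]
    linarith
  have hup : P.real {ω | (1 + ε) * μ ≤ ∑ i, Z i ω} ≤ Real.exp (-L) := by
    refine (measure_ge_le_exp_mul_mgf _ hlam0 (hint lam)).trans ?_
    refine (mul_le_mul_of_nonneg_left (hmgf lam hone) (Real.exp_pos _).le).trans ?_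
    rw [← Real.exp_add, Real.exp_le_exp]
    have : -lam * ((1 + ε) * μ) + (lam + lam ^ 2 * W) * μ = -(lam * ε * μ / 2) := by
      have : lam ^ 2 * W = lam * (ε / 2) := by rw [← hlamW]; ring
      rw [this]; ring
    linarith
  have hlo : P.real {ω | ∑ i, Z i ω ≤ (1 - ε) * μ} ≤ Real.exp (-L) := by
    refine (measure_le_le_exp_mul_mgf _ (neg_nonpos.2 hlam0) (hint (-lam))).trans ?_
    refine (mul_le_mul_of_nonneg_left (hmgf (-lam) (by rwa [abs_neg])) (Real.exp_pos _).le).trans ?_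
    rw [← Real.exp_add, Real.exp_le_exp]
    have : -(-lam) * ((1 - ε) * μ) + (-lam + (-lam) ^ 2 * W) * μ = -(lam * ε * μ / 2) := by
      have : (-lam) ^ 2 * W = lam * (ε / 2) := by rw [← hlamW]; ring
      rw [this]; ring
    linarith
  calc P.real {ω | ¬ |∑ i, Z i ω - μ| ≤ ε * μ}
      ≤ P.real ({ω | (1 + ε) * μ ≤ ∑ i, Z i ω} ∪ {ω | ∑ i, Z i ω ≤ (1 - ε) * μ}) := by
        refine measureReal_mono fun ω hω => ?_
        simp only [Set.mem_ofPred_eq, not_le, lt_abs] at hω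
        rcases hω with h | h
        · left; simp only [Set.mem_ofPred_eq]; linarith
        · right; simp only [Set.mem_ofPred_eq]; linarith
    _ ≤ _ := measureReal_union_le _ _
    _ ≤ 2 * Real.exp (-L) := by linarith

/-- If `Y` takes finitely many values and is independent of the `m₂`-measurable events `B y`, a
uniform bound on `P (B y)` is a bound on the probability of the mixture of the `B y` along `Y`. -/
lemma measureReal_mixture_le {κ : Type*} [Fintype κ] {m₁ m₂ : MeasurableSpace Ω}
    (hind : Indep m₁ m₂ P) {Y : Ω → κ} (hm₁ : m₁ ≤ mΩ)
    (hY : ∀ y, MeasurableSet[m₁] {ω | Y ω = y}) {B : κ → Set Ω}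
    (hB : ∀ y, MeasurableSet[m₂] (B y)) {δ : ℝ} (hδ : ∀ y, P.real (B y) ≤ δ) :
    P.real {ω | ω ∈ B (Y ω)} ≤ δ := by
  have hsub : {ω | ω ∈ B (Y ω)} ⊆ ⋃ y, ({ω | Y ω = y} ∩ B y) := fun ω hω =>
    Set.mem_iUnion.2 ⟨Y ω, rfl, hω⟩
  have hsum : ∑ y, P.real {ω | Y ω = y} = 1 := by
    rw [← measureReal_iUnion_fintype]
    · have : (⋃ y, {ω | Y ω = y}) = Set.univ := by ext; simp
      rw [this, probReal_univ]
    · intro y z hyz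
      refine Set.disjoint_left.2 fun ω h1 h2 => hyz (h1.symm.trans h2)
    · exact fun y => hm₁ _ (hY y)
  calc P.real {ω | ω ∈ B (Y ω)} ≤ P.real (⋃ y, ({ω | Y ω = y} ∩ B y)) := measureReal_mono hsub
    _ ≤ ∑ y, P.real ({ω | Y ω = y} ∩ B y) := measureReal_iUnion_fintype_le _
    _ = ∑ y, P.real {ω | Y ω = y} * P.real (B y) := by
        refine Finset.sum_congr rfl fun y _ => ?_
        simp only [Measure.real]
        rw [(Indep_iff m₁ m₂ P).1 hind _ _ (hY y) (hB y), ENNReal.toReal_mul]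
    _ ≤ ∑ y, P.real {ω | Y ω = y} * δ :=
        Finset.sum_le_sum fun y _ => mul_le_mul_of_nonneg_left (hδ y) measureReal_nonneg
    _ = δ := by rw [← Finset.sum_mul, hsum, one_mul]

end Chernoff

/-! ### Elementary facts on dyad probabilities -/

namespace Param

variable {n : ℕ} (Θ : Param n)

lemma k_comm (i j : Fin n) : Θ.k i j = Θ.k j i := by
  have h : Θ.rho + 2 * Θ.theta + Θ.alpha i + Θ.alpha j + Θ.beta i + Θ.beta j
      = Θ.rho + 2 * Θ.theta + Θ.alpha j + Θ.alpha i + Θ.beta j + Θ.beta i := by ring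
  rw [k, k, h]; ring

lemma k_pos (i j : Fin n) : 0 < Θ.k i j := by unfold k; positivity

lemma p_swap (a b : Fin 2) (i j : Fin n) : Θ.p a b i j = Θ.p b a j i := by
  unfold p; rw [k_comm]; congr 2; ring

lemma p_pos (a b : Fin 2) (i j : Fin n) : 0 < Θ.p a b i j :=
  div_pos (Real.exp_pos _) (Θ.k_pos i j)

lemma sum_p (i j : Fin n) : Θ.p 0 0 i j + Θ.p 0 1 i j + Θ.p 1 0 i j + Θ.p 1 1 i j = 1 := by
  have hk := (Θ.k_pos i j).ne'
  unfold p
  rw [← add_div, ← add_div, ← add_div, div_eq_one_iff_eq hk, k]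
  have h : Θ.theta + Θ.alpha i + Θ.beta j + (Θ.theta + Θ.alpha j + Θ.beta i) + Θ.rho
    = Θ.rho + 2 * Θ.theta + Θ.alpha i + Θ.alpha j + Θ.beta i + Θ.beta j := by ring
  simp [h]; ring

lemma p_le_one (a b : Fin 2) (i j : Fin n) : Θ.p a b i j ≤ 1 := by
  have := Θ.sum_p i j
  have := Θ.p_pos 0 0 i j
  have := Θ.p_pos 0 1 i j
  have := Θ.p_pos 1 0 i j
  have := Θ.p_pos 1 1 i j
  fin_cases a <;> fin_cases b <;> simp <;> linarith

end Param

/-- A sum over ordered pairs of distinct nodes, grouped by dyads. -/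
lemma sum_sum_eq_sum_dyads {n : ℕ} (h : Fin n → Fin n → ℝ) (h0 : ∀ i, h i i = 0) :
    ∑ i, ∑ j, h i j
      = ∑ e : {e : Fin n × Fin n // e.1 < e.2}, (h e.1.1 e.1.2 + h e.1.2 e.1.1) := by
  have h1 : ∀ i j, h i j = (if i < j then h i j else 0) + (if j < i then h i j else 0) := by
    intro i j
    rcases lt_trichotomy i j with hij | rfl | hij
    · simp [hij, hij.not_gt]
    · simp [h0]
    · simp [hij, hij.not_gt]
  have h2 : ∀ g : Fin n × Fin n → ℝ, ∑ e : {e : Fin n × Fin n // e.1 < e.2}, g e.1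
      = ∑ i, ∑ j, if i < j then g (i, j) else 0 := by
    intro g
    rw [← Fintype.sum_prod_type' (f := fun i j => if i < j then g (i, j) else 0),
      ← Finset.sum_filter]
    exact (Finset.sum_subtype _ (by simp) g).symm
  rw [Finset.sum_add_distrib, h2 fun e => h e.1 e.2, h2 fun e => h e.2 e.1]
  rw [Finset.sum_congr rfl fun i _ => Finset.sum_congr rfl fun j _ => h1 i j]
  simp only [Finset.sum_add_distrib]
  congr 1
  rw [Finset.sum_comm]

lemma dyadInd_nonneg {n : ℕ} (x : Fin n → Fin n → Fin 2) (d : Fin 2 × Fin 2) (i j : Fin n) :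
    0 ≤ dyadInd x d i j := by unfold dyadInd; split_ifs <;> simp

lemma dyadInd_le_one {n : ℕ} (x : Fin n → Fin n → Fin 2) (d : Fin 2 × Fin 2) (i j : Fin n) :
    dyadInd x d i j ≤ 1 := by unfold dyadInd; split_ifs <;> simp

/-- The entries of `x` in the rows and columns of `s` and `t`. -/
def incident {n : ℕ} (s t : Fin n) (x : Fin n → Fin n → Fin 2) : Fin n → Fin n → Fin 2 :=
  fun i j => if i = s ∨ i = t ∨ j = s ∨ j = t then x i j else 0

lemma dyadInd_incident {n : ℕ} {s t i j : Fin n} (x : Fin n → Fin n → Fin 2)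
    (d : Fin 2 × Fin 2) (h : i = s ∨ i = t ∨ j = s ∨ j = t) :
    dyadInd (incident s t x) d i j = dyadInd x d i j := by
  have h' : j = s ∨ j = t ∨ i = s ∨ i = t := by tauto
  simp only [dyadInd, incident, if_pos h, if_pos h']

/-! ### Weighted dyad counts in the random graph -/

namespace IsModel

variable {n : ℕ} {Θ : Param n} {Ω : Type*} [mΩ : MeasurableSpace Ω] {P : Measure Ω}
  {X : Ω → Fin n → Fin n → Fin 2}

lemma measurable_dyadInd (h : IsModel Θ P X) (d : Fin 2 × Fin 2) (i j : Fin n) :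
    Measurable fun ω => dyadInd (X ω) d i j := by
  have h1 : Measurable fun v : Fin 2 × Fin 2 => (if v = d then 1 else 0 : ℝ) :=
    measurable_of_finite _
  exact h1.comp ((h.measurable i j).prodMk (h.measurable j i))

lemma integral_dyadInd (h : IsModel Θ P X) (d : Fin 2 × Fin 2) {i j : Fin n} (hij : i ≠ j) :
    ∫ ω, dyadInd (X ω) d i j ∂P = Θ.p d.1 d.2 i j := by
  have hm : MeasurableSet {ω | (X ω i j, X ω j i) = d} :=
    ((h.measurable i j).prodMk (h.measurable j i)) (measurableSet_singleton d)
  have h1 : (fun ω => dyadInd (X ω) d i j)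
      = Set.indicator {ω | (X ω i j, X ω j i) = d} (fun _ => (1 : ℝ)) := by
    ext ω; simp [dyadInd, Set.indicator_apply]
  rw [h1, integral_indicator_const _ hm, smul_eq_mul, mul_one]
  rcases lt_or_gt_of_ne hij with hlt | hlt
  · rw [← h.law i j hlt]
    congr 1; ext ω; simp [Prod.ext_iff]
  · rw [Θ.p_swap, ← h.law j i hlt]
    congr 1; ext ω; simp [Prod.ext_iff, and_comm]

/-- Concentration of a weighted number of dyads of a given type. -/
lemma weighted_chernoff [IsProbabilityMeasure P] (h : IsModel Θ P X) (d : Fin 2 × Fin 2)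
    (w : Fin n → Fin n → ℝ) (hw0 : ∀ i j, 0 ≤ w i j) (hdiag : ∀ i, w i i = 0) {W : ℝ}
    (hWpos : 0 < W) (hW : ∀ i j, w i j + w j i ≤ W) {μ ε L : ℝ}
    (hμ : μ = ∑ i, ∑ j, w i j * Θ.p d.1 d.2 i j)
    (hε0 : 0 ≤ ε) (hε1 : ε ≤ 1) (hL : 4 * W * L ≤ ε ^ 2 * μ) :
    P.real {ω | ¬ |∑ i, ∑ j, w i j * dyadInd (X ω) d i j - μ| ≤ ε * μ} ≤ 2 * Real.exp (-L) := by
  let f : {e : Fin n × Fin n // e.1 < e.2} → Fin 2 × Fin 2 → ℝ := fun e v =>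
    w e.1.1 e.1.2 * (if v = d then 1 else 0) + w e.1.2 e.1.1 * (if v.swap = d then 1 else 0)
  have hfm : ∀ e, Measurable (f e) := fun e => measurable_of_finite _
  have hZ : ∀ ω, ∑ i, ∑ j, w i j * dyadInd (X ω) d i j
      = ∑ e : {e : Fin n × Fin n // e.1 < e.2}, f e (X ω e.1.1 e.1.2, X ω e.1.2 e.1.1) := by
    intro ω
    rw [sum_sum_eq_sum_dyads _ fun i => by rw [hdiag, zero_mul]]
    rfl
  have hi : ∀ (i j : Fin n), Integrable (fun ω => dyadInd (X ω) d i j) P := fun i j =>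
    Integrable.of_mem_Icc 0 1 (h.measurable_dyadInd d i j).aemeasurable
      (ae_of_all _ fun ω => ⟨dyadInd_nonneg _ _ _ _, dyadInd_le_one _ _ _ _⟩)
  simp_rw [hZ]
  refine chernoff (h.indep.comp f hfm)
    (fun e => (hfm e).comp ((h.measurable _ _).prodMk (h.measurable _ _))) hWpos ?_ ?_ ?_
    hε0 hε1 hL
  · intro e ω
    have := hw0 e.1.1 e.1.2
    have := hw0 e.1.2 e.1.1
    simp only [f, Function.comp]
    split_ifs <;> simp <;> linarith
  · intro e ω
    have := hw0 e.1.1 e.1.2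
    have := hw0 e.1.2 e.1.1
    have := hW e.1.1 e.1.2
    simp only [f, Function.comp]
    split_ifs <;> simp <;> linarith
  · rw [hμ, sum_sum_eq_sum_dyads _ fun i => by rw [hdiag, zero_mul]]
    refine Finset.sum_congr rfl fun e _ => ?_
    have h1 := h.integral_dyadInd d e.2.ne
    have h2 := h.integral_dyadInd d e.2.ne'
    rw [← h1, ← h2, ← integral_const_mul, ← integral_const_mul, ← integral_add]
    · rfl
    · exact (hi _ _).const_mul _
    · exact (hi _ _).const_mul _

/-- Conditionally on the dyads that meet `{s, t}`, the other dyads are still independent. -/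
lemma measureReal_mixture_le [IsProbabilityMeasure P] (h : IsModel Θ P X) (s t : Fin n)
    (e : Fin 2 × Fin 2) (w : (Fin n → Fin n → Fin 2) → Fin n → Fin n → ℝ)
    (hw : ∀ y i j, i = s ∨ i = t ∨ j = s ∨ j = t ∨ i = j → w y i j = 0)
    (B : (Fin n → Fin n → Fin 2) → Set ℝ) (hB : ∀ y, MeasurableSet (B y)) {δ : ℝ}
    (hδ : ∀ y, P.real {ω | ∑ i, ∑ j, w y i j * dyadInd (X ω) e i j ∈ B y} ≤ δ) :
    P.real {ω | ∑ i, ∑ j, w (incident s t (X ω)) i j * dyadInd (X ω) e i j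
      ∈ B (incident s t (X ω))} ≤ δ := by
  let D : {e : Fin n × Fin n // e.1 < e.2} → Ω → Fin 2 × Fin 2 := fun e ω =>
    (X ω e.1.1 e.1.2, X ω e.1.2 e.1.1)
  let m : {e : Fin n × Fin n // e.1 < e.2} → MeasurableSpace Ω := fun e =>
    MeasurableSpace.comap (D e) inferInstance
  let S : Set {e : Fin n × Fin n // e.1 < e.2} :=
    {e | e.1.1 = s ∨ e.1.1 = t ∨ e.1.2 = s ∨ e.1.2 = t}
  have hDm : ∀ e, Measurable (D e) := fun e => (h.measurable _ _).prodMk (h.measurable _ _)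
  have hmle : ∀ e, m e ≤ mΩ := fun e => (hDm e).comap_le
  have hind : Indep (⨆ e ∈ S, m e) (⨆ e ∈ Sᶜ, m e) P :=
    indep_iSup_of_disjoint hmle h.indep.iIndep disjoint_compl_right
  have hDS : ∀ (T : Set {e : Fin n × Fin n // e.1 < e.2}) (e) (_ : e ∈ T),
      Measurable[⨆ e ∈ T, m e] (D e) := fun T e he =>
    (comap_measurable (D e)).mono (le_iSup₂_of_le e he le_rfl) le_rfl
  refine P1.measureReal_mixture_le hind (Y := fun ω => incident s t (X ω))
    (iSup₂_le fun e _ => hmle e) ?_ (B := fun y => {ω | ∑ i, ∑ j, w y i j * dyadInd (X ω) e i j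
      ∈ B y}) ?_ hδ
  · intro y
    have : Measurable[⨆ e ∈ S, m e] fun ω => incident s t (X ω) := by
      refine @measurable_pi_lambda _ _ _ (_) _ _ fun i => ?_
      refine @measurable_pi_lambda _ _ _ (_) _ _ fun j => ?_
      unfold incident
      by_cases hij : i = s ∨ i = t ∨ j = s ∨ j = t
      · simp only [if_pos hij]
        rcases lt_trichotomy i j with hlt | rfl | hlt
        · exact measurable_fst.comp (hDS S ⟨(i, j), hlt⟩ hij)
        · simp only [h.loopless]; exact measurable_const
        · exact measurable_snd.comp (hDS S ⟨(j, i), hlt⟩ (by simp only [S]; tauto))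
      · simp only [if_neg hij]; exact measurable_const
    exact this (measurableSet_singleton y)
  · intro y
    have : Measurable[⨆ e ∈ Sᶜ, m e] fun ω => ∑ i, ∑ j, w y i j * dyadInd (X ω) e i j := by
      refine @Finset.measurable_sum _ _ _ _ _ _ (_) _ _ fun i _ => ?_
      refine @Finset.measurable_sum _ _ _ _ _ _ (_) _ _ fun j _ => ?_
      by_cases hij : i = s ∨ i = t ∨ j = s ∨ j = t ∨ i = j
      · simp only [hw y i j hij, zero_mul]; exact measurable_const
      · refine Measurable.const_mul ?_ _
        have hf : ∀ f : Fin 2 × Fin 2 → ℝ, Measurable f := fun f => measurable_of_finite _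
        rcases lt_trichotomy i j with hlt | rfl | hlt
        · exact (hf fun v => if v = e then 1 else 0).comp
            (hDS Sᶜ ⟨(i, j), hlt⟩ (by simp only [S, Set.mem_compl_iff, Set.mem_ofPred_eq]; tauto))
        · tauto
        · exact (hf fun v => if v.swap = e then 1 else 0).comp
            (hDS Sᶜ ⟨(j, i), hlt⟩ (by simp only [S, Set.mem_compl_iff, Set.mem_ofPred_eq]; tauto))
    exact this (hB y)

end IsModel

/-- Turns a relative error into an additive error of the logarithm, so that successive
approximations add up. The factor 2 comes from 1/(1 - ε) ≤ 1 + 2ε, valid for ε ≤ 1/2. -/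
lemma abs_log_sub_log_le {u v ε : ℝ} (hv : 0 < v) (hε : ε ≤ 1 / 2) (h : |u - v| ≤ ε * v) :
    0 < u ∧ |Real.log u - Real.log v| ≤ 2 * ε := by
  obtain ⟨h1, h2⟩ := abs_le.1 h
  have hε0 : 0 ≤ ε := by
    by_contra hneg
    have := (abs_nonneg _).trans h
    nlinarith
  have hu : 0 < u := by nlinarith
  refine ⟨hu, ?_⟩
  rw [← Real.log_div hu.ne' hv.ne', abs_le]
  have hq : 0 < u / v := div_pos hu hv
  have hq1 : u / v ≤ 1 + ε := by rw [div_le_iff₀ hv]; linarith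
  have hq2 : v / u ≤ 1 + 2 * ε := by rw [div_le_iff₀ hu]; nlinarith
  constructor
  · have := Real.one_sub_inv_le_log_of_pos hq
    rw [inv_div] at this
    linarith
  · have := Real.log_le_sub_one_of_pos hq
    linarith

/-! ### Expected triple-dyad sums and their size -/

section Triple

variable {n : ℕ}

/-- The indicator of the pairs `(k, l)` over which the triple-dyad sum runs. -/
noncomputable def admissible (s t k l : Fin n) : ℝ :=
  if k ≠ l ∧ k ≠ s ∧ k ≠ t ∧ l ≠ s ∧ l ≠ t then 1 else 0

lemma admissible_nonneg (s t k l : Fin n) : 0 ≤ admissible s t k l := by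
  unfold admissible; split_ifs <;> simp

lemma admissible_eq_zero {s t k l : Fin n} (h : k = s ∨ k = t ∨ l = s ∨ l = t ∨ k = l) :
    admissible s t k l = 0 := by
  unfold admissible; rw [if_neg]; tauto

lemma tripleSum_eq (x : Fin n → Fin n → Fin 2) (d e : Fin 2 × Fin 2) (s t : Fin n) :
    tripleSum x d e s t = ∑ k, ∑ l,
      admissible s t k l * dyadInd x d k s * dyadInd x d t l * dyadInd x e k l := by
  unfold tripleSum admissible
  refine Finset.sum_congr rfl fun k _ => Finset.sum_congr rfl fun l _ => ?_
  split_ifs <;> ring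

/-- The expected number of `(t, k)`-completions of a triple-dyad. -/
noncomputable def popInner (Θ : Param n) (d e : Fin 2 × Fin 2) (s t k : Fin n) : ℝ :=
  ∑ l, admissible s t k l * Θ.p e.1 e.2 k l * Θ.p d.1 d.2 t l

/-- The expectation of the triple-dyad sum. -/
noncomputable def popTriple (Θ : Param n) (d e : Fin 2 × Fin 2) (s t : Fin n) : ℝ :=
  ∑ k, popInner Θ d e s t k * Θ.p d.1 d.2 k s

/-- The expected number of dyads of type `d` at `t`, without those to `s`. -/
noncomputable def outerMass (Θ : Param n) (d : Fin 2 × Fin 2) (s t : Fin n) : ℝ :=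
  ∑ l, (if l = s ∨ l = t then 0 else 1) * Θ.p d.1 d.2 t l

lemma popInner_nonneg (Θ : Param n) (d e : Fin 2 × Fin 2) (s t k : Fin n) :
    0 ≤ popInner Θ d e s t k :=
  Finset.sum_nonneg fun _ _ => mul_nonneg (mul_nonneg (admissible_nonneg _ _ _ _)
    (Θ.p_pos _ _ _ _).le) (Θ.p_pos _ _ _ _).le

lemma sum_outside_ge (s t : Fin n) :
    (n : ℝ) - 2 ≤ ∑ i : Fin n, if i = s ∨ i = t then (0 : ℝ) else 1 := by
  have h : ∀ i : Fin n, (1 : ℝ) - (if i = s then 1 else 0) - (if i = t then 1 else 0)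
      ≤ if i = s ∨ i = t then (0 : ℝ) else 1 := by
    intro i
    split_ifs <;> first | tauto | norm_num
  refine le_trans ?_ (Finset.sum_le_sum fun i _ => h i)
  simp only [Finset.sum_sub_distrib, Finset.sum_ite_eq', Finset.mem_univ, if_true]
  simp
  linarith

/-- Bounds on the edge probabilities, and a precision `ε` that they can support at confidence
level `exp (-L)`. -/
structure Resolves (Θ : Param n) (d e : Fin 2 × Fin 2) (a q Q ε L : ℝ) : Prop where
  size : 4 ≤ n
  a_pos : 0 < a
  q_pos : 0 < q
  le_outer : ∀ i j, i ≠ j → a ≤ Θ.p d.1 d.2 i j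
  le_inner : ∀ i j, i ≠ j → q ≤ Θ.p e.1 e.2 i j
  inner_le : ∀ i j, i ≠ j → Θ.p e.1 e.2 i j ≤ Q
  eps_nonneg : 0 ≤ ε
  eps_le : ε ≤ 1 / 2
  one_le : 1 ≤ L
  degree : 16 * (Q * L) ≤ ε ^ 2 * (n * a * q)
  triangle : 256 * L ≤ ε ^ 2 * (n ^ 2 * a ^ 2 * q)

namespace Resolves

variable {Θ : Param n} {d e : Fin 2 × Fin 2} {a q Q ε L : ℝ}

lemma two_le_size (h : Resolves Θ d e a q Q ε L) : (2 : ℝ) ≤ n - 2 ∧ (n : ℝ) / 2 ≤ n - 2 := by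
  have : (4 : ℝ) ≤ n := by exact_mod_cast h.size
  constructor <;> linarith

lemma q_le_Q (h : Resolves Θ d e a q Q ε L) : q ≤ Q := by
  have h4 := h.size
  have hne : (⟨0, by omega⟩ : Fin n) ≠ ⟨1, by omega⟩ := by simp
  exact (h.le_inner _ _ hne).trans (h.inner_le _ _ hne)

lemma Q_pos (h : Resolves Θ d e a q Q ε L) : 0 < Q := h.q_pos.trans_le h.q_le_Q

lemma outerMass_ge (h : Resolves Θ d e a q Q ε L) (s t : Fin n) :
    n * a / 2 ≤ outerMass Θ d s t := by
  have h1 : ∑ l : Fin n, (if l = s ∨ l = t then (0 : ℝ) else 1) * a ≤ outerMass Θ d s t := by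
    refine Finset.sum_le_sum fun l _ => ?_
    split_ifs with hl
    · simp
    · simpa using h.le_outer t l (by tauto)
  rw [← Finset.sum_mul] at h1
  have := mul_le_mul_of_nonneg_right (h.two_le_size.2.trans (sum_outside_ge s t)) h.a_pos.le
  linarith

/-- The degree condition already forces n a ≥ 64, because ε² ≤ 1/4, q ≤ Q and L ≥ 1. -/
lemma two_le_outerMass (h : Resolves Θ d e a q Q ε L) (s t : Fin n) :
    2 ≤ outerMass Θ d s t := by
  refine le_trans ?_ (h.outerMass_ge s t)
  have hQ := h.Q_pos
  have hna : 0 ≤ (n : ℝ) * a := mul_nonneg (Nat.cast_nonneg n) h.a_pos.le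
  have h1 : ε ^ 2 ≤ 1 / 4 := by nlinarith [h.eps_nonneg, h.eps_le]
  have h2 : n * a * q ≤ n * a * Q := mul_le_mul_of_nonneg_left h.q_le_Q hna
  have h3 : ε ^ 2 * (n * a * q) ≤ 1 / 4 * (n * a * Q) :=
    mul_le_mul h1 h2 (mul_nonneg hna h.q_pos.le) (by norm_num)
  have h4 : Q * 1 ≤ Q * L := mul_le_mul_of_nonneg_left h.one_le hQ.le
  have h5 := h.degree
  have h6 : Q * 64 ≤ Q * (n * a) := by linarith
  have := le_of_mul_le_mul_left h6 hQ
  linarith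

/-- Compared with `outerMass`, only the term l = k is lost. It costs at most q, hence at most half
of the bound, since the outer mass is at least 2. -/
lemma inner_ge (h : Resolves Θ d e a q Q ε L) {s t k : Fin n} (hs : k ≠ s) (ht : k ≠ t) :
    q * (outerMass Θ d s t / 2) ≤ popInner Θ d e s t k := by
  have h1 : ∀ l, q * ((if l = s ∨ l = t then 0 else 1) * Θ.p d.1 d.2 t l) - (if l = k then q else 0)
      ≤ admissible s t k l * Θ.p e.1 e.2 k l * Θ.p d.1 d.2 t l := by
    intro l
    have hp := Θ.p_le_one d.1 d.2 t l
    have hp0 := (Θ.p_pos d.1 d.2 t l).le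
    have hq := h.q_pos
    by_cases hlk : l = k
    · subst hlk
      rw [admissible_eq_zero (by tauto), if_neg (by tauto), if_pos rfl]
      nlinarith
    · rw [if_neg hlk, sub_zero]
      by_cases hl : l = s ∨ l = t
      · rw [if_pos hl, admissible_eq_zero (by tauto)]; simp
      · rw [if_neg hl, admissible, if_pos (by tauto)]
        have := mul_le_mul_of_nonneg_right (h.le_inner k l (Ne.symm hlk)) hp0
        linarith
  have h2 := Finset.sum_le_sum (s := Finset.univ) fun l _ => h1 l
  rw [Finset.sum_sub_distrib, ← Finset.mul_sum, Finset.sum_ite_eq' , if_pos (Finset.mem_univ k)]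
    at h2
  change q * outerMass Θ d s t - q ≤ popInner Θ d e s t k at h2
  nlinarith [h.q_pos, h.two_le_outerMass s t]

lemma popInner_le (h : Resolves Θ d e a q Q ε L) (s t k : Fin n) :
    popInner Θ d e s t k ≤ Q * outerMass Θ d s t := by
  unfold popInner outerMass
  rw [Finset.mul_sum]
  refine Finset.sum_le_sum fun l _ => ?_
  have hp0 := (Θ.p_pos d.1 d.2 t l).le
  by_cases hl : k ≠ l ∧ k ≠ s ∧ k ≠ t ∧ l ≠ s ∧ l ≠ t
  · rw [admissible, if_pos hl, if_neg (by tauto)]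
    have := mul_le_mul_of_nonneg_right (h.inner_le k l hl.1) hp0
    linarith
  · rw [admissible, if_neg hl, zero_mul, zero_mul]
    refine mul_nonneg h.Q_pos.le (mul_nonneg ?_ hp0)
    split_ifs <;> simp

/-- The outer mass is kept as a factor: the weights in `outer_concentration` are bounded by Q times
the same mass, so it cancels there and the degree condition suffices. -/
lemma popTriple_ge (h : Resolves Θ d e a q Q ε L) (s t : Fin n) :
    n * a / 2 * (q * (outerMass Θ d s t / 2)) ≤ popTriple Θ d e s t := by
  have hm : 0 ≤ q * (outerMass Θ d s t / 2) :=
    mul_nonneg h.q_pos.le (by linarith [h.two_le_outerMass s t])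
  have h1 : ∑ k : Fin n, (if k = s ∨ k = t then (0 : ℝ) else 1) * (a * (q * (outerMass Θ d s t / 2)))
      ≤ popTriple Θ d e s t := by
    refine Finset.sum_le_sum fun k _ => ?_
    split_ifs with hk
    · rw [zero_mul]; exact mul_nonneg (popInner_nonneg _ _ _ _ _ _) (Θ.p_pos _ _ _ _).le
    · push Not at hk
      rw [one_mul, mul_comm]
      exact mul_le_mul (h.inner_ge hk.1 hk.2) (h.le_outer k s hk.1) h.a_pos.le
        (popInner_nonneg _ _ _ _ _ _)
  rw [← Finset.sum_mul] at h1
  have := mul_le_mul_of_nonneg_right (h.two_le_size.2.trans (sum_outside_ge s t))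
    (mul_nonneg h.a_pos.le hm)
  linarith

lemma popTriple_ge' (h : Resolves Θ d e a q Q ε L) (s t : Fin n) :
    n ^ 2 * a ^ 2 * q / 8 ≤ popTriple Θ d e s t := by
  refine le_trans ?_ (h.popTriple_ge s t)
  have h1 := h.outerMass_ge s t
  have h2 : 0 ≤ n * a / 2 * (q / 2) := by
    have := h.a_pos; have := h.q_pos; positivity
  have := mul_le_mul_of_nonneg_left h1 h2
  linarith

lemma popTriple_pos (h : Resolves Θ d e a q Q ε L) (s t : Fin n) : 0 < popTriple Θ d e s t := by
  refine lt_of_lt_of_le ?_ (h.popTriple_ge' s t)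
  have := h.a_pos
  have := h.q_pos
  have : (0 : ℝ) < n := by exact_mod_cast (by have := h.size; omega : 0 < n)
  positivity

end Resolves

/-! ### Concentration of the layers at t and at s -/

section Concentration

variable {Θ : Param n} {d e : Fin 2 × Fin 2} {a q Q ε L : ℝ}
  {Ω : Type*} [MeasurableSpace Ω] {P : Measure Ω} [IsProbabilityMeasure P]
  {X : Ω → Fin n → Fin n → Fin 2}

/-- The number of `(t, k)`-completions, averaged over the dyads that do not meet `t`. -/
noncomputable def condInner (Θ : Param n) (d e : Fin 2 × Fin 2) (s t : Fin n)
    (x : Fin n → Fin n → Fin 2) (k : Fin n) : ℝ :=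
  ∑ l, admissible s t k l * Θ.p e.1 e.2 k l * dyadInd x d t l

/-- Only dyads at t carry weight, each in one orientation, so W = Q works, while the mean is at
least n a q / 4. For k in {s, t} both quantities vanish. -/
lemma IsModel.condInner_concentration (hX : IsModel Θ P X) (h : Resolves Θ d e a q Q ε L)
    (s t k : Fin n) :
    P.real {ω | ¬ |condInner Θ d e s t (X ω) k - popInner Θ d e s t k|
      ≤ ε * popInner Θ d e s t k} ≤ 2 * Real.exp (-L) := by
  by_cases hk : k = s ∨ k = t
  · have h1 : ∀ x, condInner Θ d e s t x k = 0 := fun x =>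
      Finset.sum_eq_zero fun l _ => by rw [admissible_eq_zero (by tauto)]; ring
    have h2 : popInner Θ d e s t k = 0 :=
      Finset.sum_eq_zero fun l _ => by rw [admissible_eq_zero (by tauto)]; ring
    simp only [h1, h2]
    simp
    positivity
  push Not at hk
  let w : Fin n → Fin n → ℝ := fun i j =>
    if i = t then admissible s t k j * Θ.p e.1 e.2 k j else 0
  have hsum : ∀ f : Fin n → Fin n → ℝ, ∑ i, ∑ j, w i j * f i j
      = ∑ l, admissible s t k l * Θ.p e.1 e.2 k l * f t l := by
    intro f
    rw [Finset.sum_eq_single t]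
    · simp [w]
    · intro i _ hi; simp [w, hi]
    · simp
  have hle : ∀ j, admissible s t k j * Θ.p e.1 e.2 k j ≤ Q := by
    intro j
    unfold admissible
    split_ifs with hj
    · rw [one_mul]; exact h.inner_le k j hj.1
    · rw [zero_mul]; exact h.Q_pos.le
  have hw0 : ∀ i j, 0 ≤ w i j := by
    intro i j
    simp only [w]
    split_ifs
    · exact mul_nonneg (admissible_nonneg _ _ _ _) (Θ.p_pos _ _ _ _).le
    · rfl
  have hdiag : ∀ i, w i i = 0 := by
    intro i
    simp only [w]
    split_ifs with hi
    · rw [admissible_eq_zero (by tauto), zero_mul]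
    · rfl
  have key := hX.weighted_chernoff d w hw0 hdiag h.Q_pos ?_ (hsum _).symm h.eps_nonneg
    (by linarith [h.eps_le]) (L := L) ?_
  · simp_rw [hsum] at key
    exact key
  · intro i j
    by_cases hi : i = t <;> by_cases hj : j = t
    · rw [hi, hj, hdiag]; simpa using h.Q_pos.le
    · simpa [w, hi, hj] using hle j
    · simpa [w, hi, hj] using hle i
    · simpa [w, hi, hj] using h.Q_pos.le
  · have h1 := h.inner_ge hk.1 hk.2
    have h2 := mul_le_mul_of_nonneg_left (h.outerMass_ge s t) h.q_pos.le
    have h3 : n * a * q / 4 ≤ popInner Θ d e s t k := by linarith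
    have h4 := mul_le_mul_of_nonneg_left h3 (sq_nonneg ε)
    have h5 := h.degree
    change _ ≤ ε ^ 2 * popInner Θ d e s t k
    linarith

lemma IsModel.outer_concentration (hX : IsModel Θ P X) (h : Resolves Θ d e a q Q ε L)
    (s t : Fin n) :
    P.real {ω | ¬ |∑ k, popInner Θ d e s t k * dyadInd (X ω) d k s - popTriple Θ d e s t|
      ≤ ε * popTriple Θ d e s t} ≤ 2 * Real.exp (-L) := by
  let w : Fin n → Fin n → ℝ := fun i j => if j = s then popInner Θ d e s t i else 0
  have hsum : ∀ f : Fin n → Fin n → ℝ, ∑ i, ∑ j, w i j * f i j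
      = ∑ k, popInner Θ d e s t k * f k s := by
    intro f
    refine Finset.sum_congr rfl fun i _ => ?_
    rw [Finset.sum_eq_single s]
    · simp [w]
    · intro j _ hj; simp [w, hj]
    · simp
  have hB := h.two_le_outerMass s t
  have hW : 0 < Q * outerMass Θ d s t := mul_pos h.Q_pos (by linarith)
  have hw0 : ∀ i j, 0 ≤ w i j := by
    intro i j
    simp only [w]
    split_ifs
    · exact popInner_nonneg _ _ _ _ _ _
    · rfl
  have hdiag : ∀ i, w i i = 0 := by
    intro i
    simp only [w]
    split_ifs with hi
    · exact Finset.sum_eq_zero fun l _ => by rw [admissible_eq_zero (by tauto)]; ring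
    · rfl
  have key := hX.weighted_chernoff d w hw0 hdiag hW ?_ (hsum _).symm h.eps_nonneg
    (by linarith [h.eps_le]) (L := L) ?_
  · simp_rw [hsum] at key
    exact key
  · intro i j
    by_cases hi : i = s <;> by_cases hj : j = s
    · rw [hi, hj, hdiag]; simpa using hW.le
    · simpa [w, hi, hj] using h.popInner_le s t j
    · simpa [w, hi, hj] using h.popInner_le s t i
    · simpa [w, hi, hj] using hW.le
  · change _ ≤ ε ^ 2 * popTriple Θ d e s t
    have h1 := mul_le_mul_of_nonneg_left (h.popTriple_ge s t) (sq_nonneg ε)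
    have h2 := mul_le_mul_of_nonneg_right h.degree (by linarith : 0 ≤ outerMass Θ d s t / 4)
    linarith

end Concentration
end Triple

/-! ### Concentration of the whole triple-dyad sum -/

section Concentration

variable {n : ℕ} {Θ : Param n} {d e : Fin 2 × Fin 2} {a q Q ε L : ℝ}
  {Ω : Type*} [MeasurableSpace Ω] {P : Measure Ω} [IsProbabilityMeasure P]
  {X : Ω → Fin n → Fin n → Fin 2}

/-- The triple-dyad sum averaged over the dyads that do not meet `{s, t}`. -/
noncomputable def condTriple (Θ : Param n) (d e : Fin 2 × Fin 2) (s t : Fin n)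
    (x : Fin n → Fin n → Fin 2) : ℝ :=
  ∑ k, ∑ l, admissible s t k l * dyadInd x d k s * dyadInd x d t l * Θ.p e.1 e.2 k l

lemma condTriple_eq (Θ : Param n) (d e : Fin 2 × Fin 2) (s t : Fin n)
    (x : Fin n → Fin n → Fin 2) :
    condTriple Θ d e s t x = ∑ k, condInner Θ d e s t x k * dyadInd x d k s := by
  unfold condTriple condInner
  refine Finset.sum_congr rfl fun k _ => ?_
  rw [Finset.sum_mul]
  exact Finset.sum_congr rfl fun l _ => by ring

/-- The conditional mean is itself random, and Chernoff needs it to be large. The lower bound is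
therefore made part of the bad event, which is empty for realizations of the dyads at s and t that
violate it. -/
lemma IsModel.tripleSum_concentration_condTriple (hX : IsModel Θ P X)
    (h : Resolves Θ d e a q Q ε L) (s t : Fin n) :
    P.real {ω | popTriple Θ d e s t / 4 ≤ condTriple Θ d e s t (X ω) ∧
      ¬ |tripleSum (X ω) d e s t - condTriple Θ d e s t (X ω)|
        ≤ ε * condTriple Θ d e s t (X ω)} ≤ 2 * Real.exp (-L) := by
  let w : (Fin n → Fin n → Fin 2) → Fin n → Fin n → ℝ := fun y k l =>
    admissible s t k l * dyadInd y d k s * dyadInd y d t l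
  have hw0 : ∀ y i j, 0 ≤ w y i j := fun y i j =>
    mul_nonneg (mul_nonneg (admissible_nonneg _ _ _ _) (dyadInd_nonneg _ _ _ _))
      (dyadInd_nonneg _ _ _ _)
  have hw1 : ∀ y i j, w y i j ≤ 1 := by
    intro y i j
    have h1 : admissible s t i j ≤ 1 := by unfold admissible; split_ifs <;> simp
    exact mul_le_one₀ (mul_le_one₀ h1 (dyadInd_nonneg _ _ _ _) (dyadInd_le_one _ _ _ _))
      (dyadInd_nonneg _ _ _ _) (dyadInd_le_one _ _ _ _)
  have hw : ∀ y i j, i = s ∨ i = t ∨ j = s ∨ j = t ∨ i = j → w y i j = 0 := by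
    intro y i j hij
    simp only [w]
    rw [admissible_eq_zero hij]; ring
  -- The weights read only dyads that meet {s, t}, so they are functions of the part of the graph
  -- that is conditioned on.
  have hwX : ∀ ω, w (incident s t (X ω)) = w (X ω) := by
    intro ω
    ext i j
    simp only [w]
    rw [dyadInd_incident _ _ (by tauto), dyadInd_incident _ _ (by tauto)]
  let B : (Fin n → Fin n → Fin 2) → Set ℝ := fun y =>
    {z | popTriple Θ d e s t / 4 ≤ ∑ i, ∑ j, w y i j * Θ.p e.1 e.2 i j ∧
      ¬ |z - ∑ i, ∑ j, w y i j * Θ.p e.1 e.2 i j| ≤ ε * ∑ i, ∑ j, w y i j * Θ.p e.1 e.2 i j}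
  have hB : ∀ y, MeasurableSet (B y) := by
    intro y
    refine (MeasurableSet.const _).inter (MeasurableSet.compl ?_)
    exact measurableSet_le ((measurable_id.sub_const _).abs) measurable_const
  have key := hX.measureReal_mixture_le s t e w hw B hB (δ := 2 * Real.exp (-L)) ?_
  · simp only [hwX, B, Set.mem_ofPred_eq] at key
    simp only [tripleSum_eq, condTriple]
    exact key
  · intro y
    by_cases hV : popTriple Θ d e s t / 4 ≤ ∑ i, ∑ j, w y i j * Θ.p e.1 e.2 i j
    · have := hX.weighted_chernoff e (w y) (hw0 y) (fun i => hw y i i (by tauto)) (W := 2)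
        (by norm_num) (fun i j => by linarith [hw1 y i j, hw1 y j i]) rfl h.eps_nonneg
        (by linarith [h.eps_le]) (L := L) ?_
      · simpa only [B, Set.mem_ofPred_eq, hV, true_and] using this
      · have h1 := mul_le_mul_of_nonneg_left (h.popTriple_ge' s t) (sq_nonneg ε)
        have h2 := mul_le_mul_of_nonneg_left hV (sq_nonneg ε)
        have h3 := h.triangle
        linarith
    · simp only [B, Set.mem_ofPred_eq, hV, false_and]
      simp
      positivity

/-- Relative accuracy of the triple-dyad sum at a fixed pair of nodes. -/
lemma IsModel.tripleSum_concentration (hX : IsModel Θ P X)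
    (h : Resolves Θ d e a q Q ε L) (s t : Fin n) :
    P.real {ω | ¬ (0 < tripleSum (X ω) d e s t ∧
      |Real.log (tripleSum (X ω) d e s t) - Real.log (popTriple Θ d e s t)| ≤ 6 * ε)}
      ≤ (n + 2) * (2 * Real.exp (-L)) := by
  set E₁ : Fin n → Set Ω := fun k => {ω | ¬ |condInner Θ d e s t (X ω) k - popInner Θ d e s t k|
      ≤ ε * popInner Θ d e s t k} with hE₁
  set E₂ : Set Ω := {ω | ¬ |∑ k, popInner Θ d e s t k * dyadInd (X ω) d k s
      - popTriple Θ d e s t| ≤ ε * popTriple Θ d e s t} with hE₂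
  set E₃ : Set Ω := {ω | popTriple Θ d e s t / 4 ≤ condTriple Θ d e s t (X ω) ∧
      ¬ |tripleSum (X ω) d e s t - condTriple Θ d e s t (X ω)|
        ≤ ε * condTriple Θ d e s t (X ω)} with hE₃
  have hsub : {ω | ¬ (0 < tripleSum (X ω) d e s t ∧
      |Real.log (tripleSum (X ω) d e s t) - Real.log (popTriple Θ d e s t)| ≤ 6 * ε)}
      ⊆ (⋃ k, E₁ k) ∪ E₂ ∪ E₃ := by
    intro ω hω
    by_contra hnot
    refine hω ?_
    simp only [Set.mem_union, Set.mem_iUnion, not_or, not_exists, hE₁, hE₂, hE₃,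
      Set.mem_ofPred_eq, not_not, not_and] at hnot
    obtain ⟨⟨h1, h2⟩, h3⟩ := hnot
    have hμ := h.popTriple_pos s t
    have hε0 := h.eps_nonneg
    have hε1 := h.eps_le
    obtain ⟨hH, hH'⟩ := abs_log_sub_log_le hμ hε1 h2
    -- The relative error of each `condInner` passes to the sum because the indicators are
    -- nonnegative; no independence of the dyads at s and at t is used.
    have hV : |condTriple Θ d e s t (X ω) - ∑ k, popInner Θ d e s t k * dyadInd (X ω) d k s|
        ≤ ε * ∑ k, popInner Θ d e s t k * dyadInd (X ω) d k s := by
      rw [condTriple_eq, ← Finset.sum_sub_distrib, Finset.mul_sum]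
      refine (Finset.abs_sum_le_sum_abs _ _).trans (Finset.sum_le_sum fun k _ => ?_)
      rw [← sub_mul, abs_mul, abs_of_nonneg (dyadInd_nonneg _ _ _ _), ← mul_assoc]
      exact mul_le_mul_of_nonneg_right (h1 k) (dyadInd_nonneg _ _ _ _)
    obtain ⟨hV0, hV'⟩ := abs_log_sub_log_le hH hε1 hV
    -- Two relative errors of at most 1/2 leave at least the fraction (1 - ε)² ≥ 1/4.
    have hquarter : popTriple Θ d e s t / 4 ≤ condTriple Θ d e s t (X ω) := by
      have h4 := (abs_le.1 h2).1
      have h5 := (abs_le.1 hV).1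
      nlinarith
    obtain ⟨hT0, hT'⟩ := abs_log_sub_log_le hV0 hε1 (h3 hquarter)
    refine ⟨hT0, ?_⟩
    rw [abs_le] at hH' hV' hT' ⊢
    constructor <;> linarith
  calc _ ≤ P.real ((⋃ k, E₁ k) ∪ E₂ ∪ E₃) := measureReal_mono hsub
    _ ≤ P.real ((⋃ k, E₁ k) ∪ E₂) + P.real E₃ := measureReal_union_le _ _
    _ ≤ (P.real (⋃ k, E₁ k) + P.real E₂) + P.real E₃ := by
        gcongr; exact measureReal_union_le _ _
    _ ≤ (∑ k, P.real (E₁ k) + P.real E₂) + P.real E₃ := by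
        gcongr; exact measureReal_iUnion_fintype_le _
    _ ≤ (∑ _k : Fin n, 2 * Real.exp (-L) + 2 * Real.exp (-L)) + 2 * Real.exp (-L) :=
        add_le_add (add_le_add (Finset.sum_le_sum fun k _ => hX.condInner_concentration h s t k)
          (hX.outer_concentration h s t)) (hX.tripleSum_concentration_condTriple h s t)
    _ = (n + 2) * (2 * Real.exp (-L)) := by
        simp; ring

/-- The triple-dyad sums of type `(d, e)` for `x` are positive and within `6 ε` of their population
versions on the logarithmic scale. -/
def Accurate (Θ : Param n) (d e : Fin 2 × Fin 2) (ε : ℝ) (x : Fin n → Fin n → Fin 2) : Prop :=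
  ∀ s t, 0 < tripleSum x d e s t ∧
    |Real.log (tripleSum x d e s t) - Real.log (popTriple Θ d e s t)| ≤ 6 * ε

/-- Relative accuracy of the triple-dyad sums, uniformly in the pair of nodes. -/
lemma IsModel.accurate (hX : IsModel Θ P X) (h : Resolves Θ d e a q Q ε (4 * Real.log n)) :
    P.real {ω | ¬ Accurate Θ d e ε (X ω)} ≤ 4 / n := by
  have hn : (4 : ℝ) ≤ n := by exact_mod_cast h.size
  -- A failure probability n⁻⁴ per event absorbs the n² pairs (s, t) and the n + 2 events for each,
  -- with a factor 1/n to spare.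
  have hexp : Real.exp (-(4 * Real.log n)) = 1 / (n : ℝ) ^ 4 := by
    rw [Real.exp_neg, one_div, show (4 : ℝ) * Real.log n = ((4 : ℕ) : ℝ) * Real.log n by norm_num,
      Real.exp_nat_mul, Real.exp_log (by linarith)]
  have hsub : {ω | ¬ Accurate Θ d e ε (X ω)} ⊆ ⋃ st : Fin n × Fin n,
      {ω | ¬ (0 < tripleSum (X ω) d e st.1 st.2 ∧ |Real.log (tripleSum (X ω) d e st.1 st.2)
        - Real.log (popTriple Θ d e st.1 st.2)| ≤ 6 * ε)} := by
    intro ω hω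
    simp only [Accurate, Set.mem_ofPred_eq, not_forall] at hω
    obtain ⟨s, t, hst⟩ := hω
    exact Set.mem_iUnion.2 ⟨(s, t), hst⟩
  calc _ ≤ _ := measureReal_mono hsub
    _ ≤ _ := measureReal_iUnion_fintype_le _
    _ ≤ ∑ _st : Fin n × Fin n, (n + 2) * (2 * Real.exp (-(4 * Real.log n))) :=
        Finset.sum_le_sum fun st _ => hX.tripleSum_concentration h st.1 st.2
    _ = 2 * (n + 2) / (n : ℝ) ^ 2 := by
        rw [hexp]; simp; field_simp
    _ ≤ 4 / n := by
        rw [div_le_div_iff₀ (by positivity) (by linarith)]; nlinarith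

end Concentration

/-! ### Exact population ratios and the error of the estimator -/

section Population

variable {n : ℕ} (Θ : Param n)

lemma popTriple_eq_sum (d e : Fin 2 × Fin 2) (s t : Fin n) :
    popTriple Θ d e s t = ∑ k, ∑ l, admissible s t k l *
      (Θ.p d.1 d.2 k s * Θ.p e.1 e.2 k l * Θ.p d.1 d.2 t l) := by
  unfold popTriple popInner
  refine Finset.sum_congr rfl fun k _ => ?_
  rw [Finset.sum_mul]
  exact Finset.sum_congr rfl fun l _ => by ring

/-- Holds term by term: both products have denominator k_ks k_kl k_tl, and the numerators have
exponents (θ + α_s + β_k) + (θ + α_l + β_t) and θ + α_l + β_k. -/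
lemma popTriple_ratio (s t : Fin n) :
    popTriple Θ (0, 1) (0, 0) s t
      = Real.exp (Θ.theta + Θ.alpha s + Θ.beta t) * popTriple Θ (0, 0) (0, 1) s t := by
  rw [popTriple_eq_sum, popTriple_eq_sum, Finset.mul_sum]
  refine Finset.sum_congr rfl fun k _ => ?_
  rw [Finset.mul_sum]
  refine Finset.sum_congr rfl fun l _ => ?_
  rw [mul_left_comm (Real.exp _)]
  congr 1
  unfold Param.p
  have := (Θ.k_pos k s).ne'
  have := (Θ.k_pos k l).ne'
  have := (Θ.k_pos t l).ne'
  field_simp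
  simp only [← Real.exp_add]
  congr 1
  simp
  ring

lemma popTriple_ratio_rec (t : Fin n) :
    popTriple Θ (1, 1) (1, 0) t t = Real.exp (Θ.rho + Θ.theta + Θ.alpha t + Θ.beta t)
      * popTriple Θ (1, 0) (1, 1) t t := by
  rw [popTriple_eq_sum, popTriple_eq_sum, Finset.mul_sum]
  refine Finset.sum_congr rfl fun k _ => ?_
  rw [Finset.mul_sum]
  refine Finset.sum_congr rfl fun l _ => ?_
  rw [mul_left_comm (Real.exp _)]
  congr 1
  unfold Param.p
  have := (Θ.k_pos k t).ne'
  have := (Θ.k_pos k l).ne'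
  have := (Θ.k_pos t l).ne'
  field_simp
  simp only [← Real.exp_add]
  congr 1
  simp
  ring

variable {Θ}

lemma abs_log_ratio_sub_le {T₁ T₂ μ₁ μ₂ c δ : ℝ} (hT₁ : 0 < T₁) (hT₂ : 0 < T₂) (hμ₂ : 0 < μ₂)
    (hμ : μ₁ = Real.exp c * μ₂) (h₁ : |Real.log T₁ - Real.log μ₁| ≤ δ)
    (h₂ : |Real.log T₂ - Real.log μ₂| ≤ δ) : |Real.log (T₁ / T₂) - c| ≤ 2 * δ := by
  rw [hμ, Real.log_mul (Real.exp_pos c).ne' hμ₂.ne', Real.log_exp] at h₁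
  rw [Real.log_div hT₁.ne' hT₂.ne']
  rw [abs_le] at h₁ h₂ ⊢
  constructor <;> linarith

lemma abs_mean_sub_le {m : ℕ} (hm : 1 ≤ m) {f g : Fin m → ℝ} {c δ : ℝ}
    (hg : ∑ t, g t = m * c) (h : ∀ t, |f t - g t| ≤ δ) : |1 / (m : ℝ) * ∑ t, f t - c| ≤ δ := by
  have hm' : (0 : ℝ) < m := by exact_mod_cast hm
  have h1 : 1 / (m : ℝ) * ∑ t, f t - c = 1 / (m : ℝ) * ∑ t, (f t - g t) := by
    rw [Finset.sum_sub_distrib, hg]; field_simp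
  have h2 : |∑ t, (f t - g t)| ≤ m * δ := by
    refine (Finset.abs_sum_le_sum_abs _ _).trans ((Finset.sum_le_sum fun t _ => h t).trans ?_)
    simp
  rw [h1, abs_mul, abs_of_pos (by positivity), one_div, inv_mul_le_iff₀ hm']
  exact h2

/-- Accuracy of the triple-dyad sums is inherited by the estimator. -/
lemma estimator_error {x : Fin n → Fin n → Fin 2} (hn : 1 ≤ n) (hΘ : Θ.Identified) {ε η : ℝ}
    (hpos₁ : ∀ s t, 0 < popTriple Θ (0, 0) (0, 1) s t)
    (hpos₂ : ∀ s t, 0 < popTriple Θ (1, 0) (1, 1) s t)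
    (h₁ : Accurate Θ (0, 1) (0, 0) ε x) (h₂ : Accurate Θ (0, 0) (0, 1) ε x)
    (h₃ : Accurate Θ (1, 1) (1, 0) η x) (h₄ : Accurate Θ (1, 0) (1, 1) η x) :
    WellDefined x ∧ |rhoHat x - Θ.rho| ≤ 12 * η + 12 * ε ∧ |thetaHat x - Θ.theta| ≤ 12 * ε ∧
      (∀ i, |alphaHat x i - Θ.alpha i| ≤ 24 * ε) ∧ (∀ j, |betaHat x j - Θ.beta j| ≤ 24 * ε) := by
  obtain ⟨hα, hβ⟩ := hΘ
  have hR : ∀ s t, |logRatio x s t - (Θ.theta + Θ.alpha s + Θ.beta t)| ≤ 2 * (6 * ε) := fun s t =>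
    abs_log_ratio_sub_le (h₁ s t).1 (h₂ s t).1 (hpos₁ s t) (popTriple_ratio Θ s t)
      (h₁ s t).2 (h₂ s t).2
  have hR' : ∀ t, |logRatioRec x t - (Θ.rho + Θ.theta + Θ.alpha t + Θ.beta t)| ≤ 2 * (6 * η) :=
    fun t => abs_log_ratio_sub_le (h₃ t t).1 (h₄ t t).1 (hpos₂ t t) (popTriple_ratio_rec Θ t)
      (h₃ t t).2 (h₄ t t).2
  have hθ : |thetaHat x - Θ.theta| ≤ 2 * (6 * ε) :=
    abs_mean_sub_le hn (by simp [Finset.sum_add_distrib, hα, hβ]) fun t => hR t t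
  have hρ := abs_mean_sub_le hn (f := logRatioRec x) (c := Θ.rho + Θ.theta)
    (by simp [Finset.sum_add_distrib, hα, hβ]; ring) hR'
  have hA := fun i => abs_mean_sub_le hn (f := fun t => logRatio x i t) (c := Θ.theta + Θ.alpha i)
    (by simp [Finset.sum_add_distrib, hβ]; ring) (hR i)
  have hB := fun j => abs_mean_sub_le hn (f := fun t => logRatio x t j) (c := Θ.theta + Θ.beta j)
    (by simp [Finset.sum_add_distrib, hα]; ring) fun t => hR t j
  rw [abs_le] at hθ hρ
  simp only [abs_le] at hA hB ⊢
  refine ⟨⟨fun s t => ⟨(h₁ s t).1, (h₂ s t).1⟩, fun t => ⟨(h₃ t t).1, (h₄ t t).1⟩⟩, ?_, ?_, ?_, ?_⟩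
  · unfold rhoHat; constructor <;> linarith
  · constructor <;> linarith
  · intro i; unfold alphaHat; have := hA i; constructor <;> linarith
  · intro j; unfold betaHat; have := hB j; constructor <;> linarith

lemma IsModel.estimator_concentration {Ω : Type*} [MeasurableSpace Ω] {P : Measure Ω}
    [IsProbabilityMeasure P] {X : Ω → Fin n → Fin n → Fin 2} (hX : IsModel Θ P X)
    (hΘ : Θ.Identified) {ε η a₁ q₁ Q₁ a₂ q₂ Q₂ a₃ q₃ Q₃ a₄ q₄ Q₄ : ℝ}
    (h₁ : Resolves Θ (0, 1) (0, 0) a₁ q₁ Q₁ ε (4 * Real.log n))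
    (h₂ : Resolves Θ (0, 0) (0, 1) a₂ q₂ Q₂ ε (4 * Real.log n))
    (h₃ : Resolves Θ (1, 1) (1, 0) a₃ q₃ Q₃ η (4 * Real.log n))
    (h₄ : Resolves Θ (1, 0) (1, 1) a₄ q₄ Q₄ η (4 * Real.log n)) :
    1 - 16 / (n : ℝ) ≤ P.real {ω | WellDefined (X ω) ∧
      |rhoHat (X ω) - Θ.rho| ≤ 12 * η + 12 * ε ∧ |thetaHat (X ω) - Θ.theta| ≤ 12 * ε ∧
      (∀ i, |alphaHat (X ω) i - Θ.alpha i| ≤ 24 * ε) ∧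
      (∀ j, |betaHat (X ω) j - Θ.beta j| ≤ 24 * ε)} := by
  set G := {ω | WellDefined (X ω) ∧
      |rhoHat (X ω) - Θ.rho| ≤ 12 * η + 12 * ε ∧ |thetaHat (X ω) - Θ.theta| ≤ 12 * ε ∧
      (∀ i, |alphaHat (X ω) i - Θ.alpha i| ≤ 24 * ε) ∧
      (∀ j, |betaHat (X ω) j - Θ.beta j| ≤ 24 * ε)} with hG
  have hcover : (Set.univ : Set Ω) ⊆ G ∪ ({ω | ¬ Accurate Θ (0, 1) (0, 0) ε (X ω)} ∪
      ({ω | ¬ Accurate Θ (0, 0) (0, 1) ε (X ω)} ∪ ({ω | ¬ Accurate Θ (1, 1) (1, 0) η (X ω)} ∪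
        {ω | ¬ Accurate Θ (1, 0) (1, 1) η (X ω)}))) := by
    intro ω _
    by_contra hω
    simp only [Set.mem_union, Set.mem_ofPred_eq, not_or, not_not] at hω
    obtain ⟨h0, b1, b2, b3, b4⟩ := hω
    exact h0 (estimator_error (by have := h₁.size; omega) hΘ h₂.popTriple_pos h₄.popTriple_pos
      b1 b2 b3 b4)
  have h0 := measureReal_mono (μ := P) hcover
  rw [probReal_univ] at h0
  have u1 := h0.trans (measureReal_union_le _ _)
  have u2 := u1.trans (add_le_add_right (measureReal_union_le _ _) _)
  have u3 := measureReal_union_le (μ := P) {ω | ¬ Accurate Θ (0, 0) (0, 1) ε (X ω)}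
    ({ω | ¬ Accurate Θ (1, 1) (1, 0) η (X ω)} ∪ {ω | ¬ Accurate Θ (1, 0) (1, 1) η (X ω)})
  have u4 := measureReal_union_le (μ := P) {ω | ¬ Accurate Θ (1, 1) (1, 0) η (X ω)}
    {ω | ¬ Accurate Θ (1, 0) (1, 1) η (X ω)}
  have a1 := hX.accurate h₁
  have a2 := hX.accurate h₂
  have a3 := hX.accurate h₃
  have a4 := hX.accurate h₄
  have : (16 : ℝ) / n = 4 / n + 4 / n + 4 / n + 4 / n := by ring
  linarith

end Population

/-! ### Bounded parameters -/

section Bounded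

variable {n : ℕ} {Θ : Param n}

/-- The longest exponent, ρ + 2θ + α_i + α_j + β_i + β_j, has total coefficient 7. Numerators are
thus at least e^(-7C), and k_ij is at most 4 e^(7C). -/
lemma Param.p_ge_of_norm_le {C : ℝ} (hΘ : ‖Θ‖ ≤ C) (a b : Fin 2) (i j : Fin n) :
    Real.exp (-(14 * C)) / 4 ≤ Θ.p a b i j := by
  have hρ : ‖Θ.rho‖ ≤ C := (norm_fst_le Θ).trans hΘ
  have h2 : ‖Θ.2‖ ≤ C := (norm_snd_le Θ).trans hΘ
  have hθ : ‖Θ.theta‖ ≤ C := (norm_fst_le Θ.2).trans h2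
  have h3 : ‖Θ.2.2‖ ≤ C := (norm_snd_le Θ.2).trans h2
  have hα : ∀ i, ‖Θ.alpha i‖ ≤ C := fun i =>
    (norm_le_pi_norm _ i).trans ((norm_fst_le Θ.2.2).trans h3)
  have hβ : ∀ i, ‖Θ.beta i‖ ≤ C := fun i =>
    (norm_le_pi_norm _ i).trans ((norm_snd_le Θ.2.2).trans h3)
  simp only [Real.norm_eq_abs, abs_le] at hρ hθ hα hβ
  have hi := hα i
  have hj := hα j
  have hi' := hβ i
  have hj' := hβ j
  have hk : Θ.k i j ≤ 4 * Real.exp (7 * C) := by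
    have h0 : (1 : ℝ) ≤ Real.exp (7 * C) := Real.one_le_exp (by linarith)
    have h1 : Real.exp (Θ.theta + Θ.alpha i + Θ.beta j) ≤ Real.exp (7 * C) :=
      Real.exp_le_exp.2 (by linarith)
    have h2 : Real.exp (Θ.theta + Θ.alpha j + Θ.beta i) ≤ Real.exp (7 * C) :=
      Real.exp_le_exp.2 (by linarith)
    have h3 : Real.exp (Θ.rho + 2 * Θ.theta + Θ.alpha i + Θ.alpha j + Θ.beta i + Θ.beta j)
        ≤ Real.exp (7 * C) := Real.exp_le_exp.2 (by linarith)
    unfold Param.k; linarith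
  have hnum : Real.exp (-(14 * C)) / 4 = Real.exp (-(7 * C)) / (4 * Real.exp (7 * C)) := by
    rw [show -(14 * C) = -(7 * C) - 7 * C by ring, Real.exp_sub]; field_simp
  rw [hnum]
  unfold Param.p
  refine div_le_div₀ (Real.exp_pos _).le (Real.exp_le_exp.2 ?_) (Θ.k_pos i j) hk
  fin_cases a <;> fin_cases b <;> simp <;> linarith

lemma resolves_of_norm_le {C M δ : ℝ} (hδ : δ = Real.exp (-(14 * C)) / 4) (hΘ : ‖Θ‖ ≤ C)
    (hn : 4 ≤ n) (hlog : 1 ≤ 4 * Real.log n) (hM0 : 0 ≤ M) (hM : 1024 ≤ M ^ 2 * δ ^ 3)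
    (hε : M * Real.sqrt (Real.log n / n) ≤ 1 / 2) (d e : Fin 2 × Fin 2) :
    Resolves Θ d e δ δ 1 (M * Real.sqrt (Real.log n / n)) (4 * Real.log n) := by
  have hδ0 : 0 < δ := by rw [hδ]; positivity
  have hp : ∀ a b i j, δ ≤ Θ.p a b i j := by rw [hδ]; exact Θ.p_ge_of_norm_le hΘ
  have hδ1 : δ ≤ 1 := (hp 0 0 ⟨0, by omega⟩ ⟨0, by omega⟩).trans (Θ.p_le_one _ _ _ _)
  have hn' : (4 : ℝ) ≤ n := by exact_mod_cast hn
  have hl : 0 ≤ Real.log n := by linarith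
  have hsq : (M * Real.sqrt (Real.log n / n)) ^ 2 = M ^ 2 * (Real.log n / n) := by
    rw [mul_pow, Real.sq_sqrt (by positivity)]
  refine ⟨hn, hδ0, hδ0, fun i j _ => hp _ _ i j, fun i j _ => hp _ _ i j,
    fun i j _ => Θ.p_le_one _ _ i j, by positivity, hε, hlog, ?_, ?_⟩
  · rw [hsq]
    have h1 : M ^ 2 * (Real.log n / n) * (n * δ * δ) = M ^ 2 * δ ^ 2 * Real.log n := by
      field_simp
    have h2 : M ^ 2 * δ ^ 3 ≤ M ^ 2 * δ ^ 2 :=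
      mul_le_mul_of_nonneg_left (pow_le_pow_of_le_one hδ0.le hδ1 (by norm_num)) (sq_nonneg M)
    rw [h1]; nlinarith
  · rw [hsq]
    have h1 : M ^ 2 * (Real.log n / n) * (n ^ 2 * δ ^ 2 * δ)
        = M ^ 2 * δ ^ 3 * (Real.log n * n) := by
      field_simp
    have h2 : Real.log n * 1 ≤ Real.log n * n := mul_le_mul_of_nonneg_left (by linarith) hl
    rw [h1]; nlinarith

end Bounded

lemma three_quarters_le_log {n : ℕ} (hn : 4 ≤ n) : 3 / 4 ≤ Real.log n := by
  have hn' : (4 : ℝ) ≤ n := by exact_mod_cast hn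
  have h1 := Real.one_sub_inv_le_log_of_pos (by linarith : (0 : ℝ) < n)
  have h2 : (n : ℝ)⁻¹ ≤ 4⁻¹ := inv_anti₀ (by norm_num) hn'
  norm_num at h2
  linarith

lemma exists_mul_sqrt_log_div_le (M : ℝ) :
    ∃ N : ℕ, 4 ≤ N ∧ ∀ n : ℕ, N ≤ n → M * Real.sqrt (Real.log n / n) ≤ 1 / 2 := by
  have h1 : Tendsto (fun n : ℕ => Real.log n / n) atTop (nhds 0) :=
    Real.isLittleO_log_id_atTop.tendsto_div_nhds_zero.comp tendsto_natCast_atTop_atTop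
  have h2 : Tendsto (fun n : ℕ => M * Real.sqrt (Real.log n / n)) atTop (nhds 0) := by
    have := (h1.sqrt).const_mul M
    simpa using this
  obtain ⟨N, hN⟩ := eventually_atTop.1 (h2.eventually_le_const (by norm_num : (0 : ℝ) < 1 / 2))
  exact ⟨max N 4, le_max_right _ _, fun n hn => hN n ((le_max_left _ _).trans hn)⟩

lemma exists_error_bound_of_norm_le (C : ℝ) : ∃ M : ℝ, 0 < M ∧ ∀ n : ℕ, 1 ≤ n →
    ∀ Θ : Param n, Θ.Identified → ‖Θ‖ ≤ C → ∀ (Ω : Type*) [MeasurableSpace Ω] (P : Measure Ω)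
      [IsProbabilityMeasure P] (X : Ω → Fin n → Fin n → Fin 2), IsModel Θ P X →
      1 - M / n ≤ P.real {ω | WellDefined (X ω) ∧
        ‖estimator (X ω) - Θ‖ ≤ M * Real.sqrt (Real.log n / n)} := by
  set δ : ℝ := Real.exp (-(14 * C)) / 4 with hδ
  have hδ0 : 0 < δ := by positivity
  set M₀ : ℝ := Real.sqrt (1024 / δ ^ 3) with hM₀
  have hM₀0 : 0 ≤ M₀ := Real.sqrt_nonneg _
  have hM₀sq : M₀ ^ 2 * δ ^ 3 = 1024 := by
    rw [hM₀, Real.sq_sqrt (by positivity)]; field_simp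
  obtain ⟨N, hN4, hN⟩ := exists_mul_sqrt_log_div_le M₀
  -- The three summands cover the failure probability 16/n, the sizes n < N, where the claimed
  -- probability bound is nonpositive, and the error 24 ε.
  refine ⟨16 + N + 24 * M₀, by positivity, fun n hn1 Θ hI hΘ Ω _ P _ X hX => ?_⟩
  have hn0 : (0 : ℝ) < n := by exact_mod_cast hn1
  rcases lt_or_ge n N with hn | hn
  · have h1 : (n : ℝ) ≤ N := by exact_mod_cast hn.le
    have h2 : 1 ≤ (16 + N + 24 * M₀) / n := by rw [le_div_iff₀ hn0]; linarith
    exact le_trans (by linarith) measureReal_nonneg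
  have hn4 := hN4.trans hn
  have hlog := three_quarters_le_log hn4
  have hres := resolves_of_norm_le (M := M₀) hδ hΘ hn4 (by linarith) hM₀0 hM₀sq.ge (hN n hn)
  have key := hX.estimator_concentration hI (hres _ _) (hres _ _) (hres _ _) (hres _ _)
  have hprob : 1 - (16 + N + 24 * M₀) / (n : ℝ) ≤ 1 - 16 / n := by
    gcongr
    linarith [(Nat.cast_nonneg N : (0 : ℝ) ≤ N)]
  refine (hprob.trans key).trans (measureReal_mono ?_)
  rintro ω ⟨hwd, hρ, hθ, hα, hβ⟩
  refine ⟨hwd, ?_⟩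
  set r := Real.sqrt (Real.log n / n)
  have hr : 0 ≤ r := Real.sqrt_nonneg _
  have hle : 24 * (M₀ * r) ≤ (16 + N + 24 * M₀) * r := by
    have : 0 ≤ (16 + N) * r := by positivity
    linarith
  have hb : 0 ≤ (16 + N + 24 * M₀) * r := by positivity
  have hθ0 : 0 ≤ M₀ * r := by positivity
  refine norm_prod_le_iff.2 ⟨?_, norm_prod_le_iff.2 ⟨?_, norm_prod_le_iff.2 ⟨?_, ?_⟩⟩⟩
  · change |rhoHat (X ω) - Θ.rho| ≤ _; linarith
  · change |thetaHat (X ω) - Θ.theta| ≤ _; linarith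
  · refine (pi_norm_le_iff_of_nonneg hb).2 fun i => ?_
    change |alphaHat (X ω) i - Θ.alpha i| ≤ _; linarith [hα i]
  · refine (pi_norm_le_iff_of_nonneg hb).2 fun i => ?_
    change |betaHat (X ω) i - Θ.beta i| ≤ _; linarith [hβ i]

/-! ### Sparse regime: consequences of the growth conditions -/

section Sparse

namespace Param

variable {n : ℕ} (Θ : Param n)

lemma minAsym_le {i j : Fin n} (h : i ≠ j) : Θ.minAsym ≤ Θ.p 1 0 i j :=
  ciInf_le (Set.finite_range _).bddBelow (⟨(i, j), h⟩ : {e : Fin n × Fin n // e.1 ≠ e.2})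

lemma le_maxAsym {i j : Fin n} (h : i ≠ j) : Θ.p 1 0 i j ≤ Θ.maxAsym :=
  le_ciSup (f := fun e : {e : Fin n × Fin n // e.1 ≠ e.2} => Θ.p 1 0 e.1.1 e.1.2)
    (Set.finite_range _).bddAbove ⟨(i, j), h⟩

lemma nonempty_pairs (hn : 2 ≤ n) : Nonempty {e : Fin n × Fin n // e.1 ≠ e.2} :=
  ⟨⟨(⟨0, by omega⟩, ⟨1, by omega⟩), by simp⟩⟩

lemma minAsym_pos (hn : 2 ≤ n) : 0 < Θ.minAsym := by
  have := nonempty_pairs hn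
  obtain ⟨e, he⟩ := exists_eq_ciInf_of_finite
    (f := fun e : {e : Fin n × Fin n // e.1 ≠ e.2} => Θ.p 1 0 e.1.1 e.1.2)
  exact (Θ.p_pos 1 0 _ _).trans_eq he

lemma minAsym_le_maxAsym (hn : 2 ≤ n) : Θ.minAsym ≤ Θ.maxAsym := by
  obtain ⟨e⟩ := nonempty_pairs hn
  exact (Θ.minAsym_le e.2).trans (Θ.le_maxAsym e.2)

lemma maxAsym_le_one (hn : 2 ≤ n) : Θ.maxAsym ≤ 1 := by
  have := nonempty_pairs hn
  exact ciSup_le fun e => Θ.p_le_one _ _ _ _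

/-- The defining identity of reciprocity: ρ is the log odds ratio of a dyad. It yields lower bounds
for both p¹¹ and p⁰⁰ from c_n alone and the upper bound on p¹¹. -/
lemma p_mutual_mul_p_null (i j : Fin n) :
    Θ.p 1 1 i j * Θ.p 0 0 i j = Real.exp Θ.rho * (Θ.p 1 0 i j * Θ.p 1 0 j i) := by
  rw [Θ.p_swap 1 0 j i]
  unfold p
  have := (Θ.k_pos i j).ne'
  field_simp
  simp only [← Real.exp_add]
  congr 1
  simp
  ring

lemma p_asym_le_exp (i j : Fin n) :
    Θ.p 1 0 i j ≤ Real.exp (Θ.theta + Θ.alpha i + Θ.beta j) := by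
  have h1 : 1 ≤ Θ.k i j := by
    unfold k
    have := Real.exp_pos (Θ.theta + Θ.alpha i + Θ.beta j)
    have := Real.exp_pos (Θ.theta + Θ.alpha j + Θ.beta i)
    have := Real.exp_pos (Θ.rho + 2 * Θ.theta + Θ.alpha i + Θ.alpha j + Θ.beta i + Θ.beta j)
    linarith
  unfold p
  rw [div_le_iff₀ (Θ.k_pos i j)]
  simp
  exact le_mul_of_one_le_right (Real.exp_pos _).le h1

/-- By the identification constraints, `θ` is the mean of `log (p₁₀ / p₀₀)` along a cyclic shift. -/
lemma minAsym_le_exp_theta (hn : 2 ≤ n) (hΘ : Θ.Identified) : Θ.minAsym ≤ Real.exp Θ.theta := by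
  obtain ⟨m, rfl⟩ : ∃ m, n = m + 2 := ⟨n - 2, by omega⟩
  obtain ⟨hα, hβ⟩ := hΘ
  have hc := Θ.minAsym_pos hn
  rw [← Real.log_le_iff_le_exp hc]
  -- The shift i ↦ i + 1 is taken modulo m + 2 ≥ 2, so it has no fixed point and permutes the nodes;
  -- summing over i makes the α and β terms vanish.
  have h1 : ∀ i : Fin (m + 2), Real.log Θ.minAsym ≤ Θ.theta + Θ.alpha i + Θ.beta (i + 1) := by
    intro i
    rw [Real.log_le_iff_le_exp hc]
    refine (Θ.minAsym_le ?_).trans (Θ.p_asym_le_exp i (i + 1))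
    simp
  have h2 := Finset.sum_le_sum (s := Finset.univ) fun i _ => h1 i
  have h3 : ∑ i : Fin (m + 2), Θ.beta (i + 1) = 0 := by
    rw [← hβ]; exact Equiv.sum_comp (Equiv.addRight 1) Θ.beta
  simp only [Finset.sum_add_distrib, hα, h3, Finset.sum_const, Finset.card_univ,
    Fintype.card_fin, nsmul_eq_mul, add_zero] at h2
  exact le_of_mul_le_mul_left h2 (by positivity)

end Param

/-- The inequalities that the sparse regime provides at a single size `n`. -/
structure SparseAt {n : ℕ} (K δ : ℝ) (Θ : Param n) : Prop where
  size : 4 ≤ n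
  one_le : 1 ≤ K
  identified : Θ.Identified
  delta_pos : 0 < δ
  delta_le : δ ≤ 1 / 16
  rho_add_theta : Θ.rho + Θ.theta ≤ 0
  mutual_le : ∀ i j : Fin n, i ≠ j → Θ.p 1 1 i j ≤ K * (Real.exp Θ.rho * Θ.maxAsym ^ 2)
  degree : Real.log n / n ≤ δ * (Real.exp Θ.rho * Θ.minAsym ^ 10 / Θ.maxAsym ^ 8)
  triangle : Real.log n / (n : ℝ) ^ 2
    ≤ δ * (Real.exp (2 * Θ.rho) * Θ.minAsym ^ 10 / Θ.maxAsym ^ 5)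

namespace SparseAt

variable {n : ℕ} {Θ : Param n} {K δ : ℝ}

lemma two_le (h : SparseAt K δ Θ) : 2 ≤ n := by have := h.size; omega

lemma cast_pos (h : SparseAt K δ Θ) : (0 : ℝ) < n := by
  exact_mod_cast (by have := h.size; omega : 0 < n)

lemma minAsym_pos (h : SparseAt K δ Θ) : 0 < Θ.minAsym := Θ.minAsym_pos h.two_le

lemma maxAsym_pos (h : SparseAt K δ Θ) : 0 < Θ.maxAsym :=
  h.minAsym_pos.trans_le (Θ.minAsym_le_maxAsym h.two_le)

lemma log_pos (h : SparseAt K δ Θ) : 0 < Real.log n := by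
  linarith [three_quarters_le_log h.size]

/-- From c_n ≤ e^θ and ρ + θ ≤ 0. This is what trades powers of e^ρ for powers of c_n when rates are
compared. -/
lemma exp_rho_mul_minAsym_le (h : SparseAt K δ Θ) : Real.exp Θ.rho * Θ.minAsym ≤ 1 := by
  have h1 := mul_le_mul_of_nonneg_left (Θ.minAsym_le_exp_theta h.two_le h.identified)
    (Real.exp_pos Θ.rho).le
  rw [← Real.exp_add] at h1
  exact h1.trans (Real.exp_le_one_iff.2 h.rho_add_theta)

lemma pow_minAsym_le (h : SparseAt K δ Θ) (m : ℕ) : Θ.minAsym ^ m ≤ Θ.maxAsym ^ m :=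
  pow_le_pow_left₀ h.minAsym_pos.le (Θ.minAsym_le_maxAsym h.two_le) m

/-- The right side of the degree condition is at most c_n/16, because e^ρ c_n ≤ 1 and c_n ≤ C_n; and
log n ≥ 3/4. -/
lemma one_le_mul_minAsym (h : SparseAt K δ Θ) : 1 ≤ n * Θ.minAsym := by
  have hc := h.minAsym_pos
  have hC := h.maxAsym_pos
  have h1 : Real.exp Θ.rho * Θ.minAsym ^ 10 / Θ.maxAsym ^ 8 ≤ Θ.minAsym := by
    rw [div_le_iff₀ (by positivity)]
    calc Real.exp Θ.rho * Θ.minAsym ^ 10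
        = (Real.exp Θ.rho * Θ.minAsym) * (Θ.minAsym * Θ.minAsym ^ 8) := by ring
      _ ≤ 1 * (Θ.minAsym * Θ.maxAsym ^ 8) := by
          gcongr
          · exact h.exp_rho_mul_minAsym_le
          · exact Θ.minAsym_le_maxAsym h.two_le
      _ = _ := one_mul _
  have h2 := h.degree.trans (mul_le_mul h.delta_le h1 (by positivity) (by norm_num))
  rw [div_le_iff₀ h.cast_pos] at h2
  have := three_quarters_le_log h.size
  linarith

lemma exp_mul_sq_le (h : SparseAt K δ Θ) {i j : Fin n} (hij : i ≠ j) :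
    Real.exp Θ.rho * Θ.minAsym ^ 2 ≤ Θ.p 1 1 i j * Θ.p 0 0 i j := by
  rw [Θ.p_mutual_mul_p_null, sq]
  exact mul_le_mul_of_nonneg_left (mul_le_mul (Θ.minAsym_le hij) (Θ.minAsym_le hij.symm)
    h.minAsym_pos.le (Θ.p_pos _ _ _ _).le) (Real.exp_pos _).le

lemma le_p_mutual (h : SparseAt K δ Θ) {i j : Fin n} (hij : i ≠ j) :
    Real.exp Θ.rho * Θ.minAsym ^ 2 ≤ Θ.p 1 1 i j :=
  (h.exp_mul_sq_le hij).trans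
    (mul_le_of_le_one_right (Θ.p_pos _ _ _ _).le (Θ.p_le_one _ _ _ _))

lemma le_p_null (h : SparseAt K δ Θ) {i j : Fin n} (hij : i ≠ j) :
    Θ.minAsym ^ 2 / (K * Θ.maxAsym ^ 2) ≤ Θ.p 0 0 i j := by
  have hC := h.maxAsym_pos
  have hK : 0 < K := by linarith [h.one_le]
  rw [div_le_iff₀ (by positivity)]
  have h1 := (h.exp_mul_sq_le hij).trans
    (mul_le_mul_of_nonneg_right (h.mutual_le i j hij) (Θ.p_pos 0 0 i j).le)
  refine le_of_mul_le_mul_left (h1.trans_eq ?_) (Real.exp_pos Θ.rho)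
  ring

/-- the square of `mainRate` is at most that of the second summand of `rhoRate` -/
lemma main_le (h : SparseAt K δ Θ) :
    Θ.maxAsym ^ 3 * Real.log n / (n * Θ.minAsym ^ 4)
      ≤ Θ.maxAsym ^ 8 * Real.log n / (Real.exp Θ.rho * n * Θ.minAsym ^ 10) := by
  have hc := h.minAsym_pos
  have hC := h.maxAsym_pos
  have hn := h.cast_pos
  have hl := h.log_pos
  have hE := Real.exp_pos Θ.rho
  rw [div_le_div_iff₀ (by positivity) (by positivity)]
  have h1 : (Real.exp Θ.rho * Θ.minAsym) * Θ.minAsym ^ 5 ≤ 1 * Θ.maxAsym ^ 5 :=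
    mul_le_mul h.exp_rho_mul_minAsym_le (h.pow_minAsym_le 5) (by positivity) (by norm_num)
  have h2 := mul_le_mul_of_nonneg_left h1
    (by positivity : 0 ≤ Θ.maxAsym ^ 3 * Real.log n * n * Θ.minAsym ^ 4)
  linarith

/-- Needed because the error of θ̂ enters that of ρ̂. -/
lemma mainRate_le_rhoRate (h : SparseAt K δ Θ) : mainRate Θ ≤ rhoRate Θ :=
  (Real.sqrt_le_sqrt h.main_le).trans (le_add_of_nonneg_left (Real.sqrt_nonneg _))

lemma rhoRate_le (h : SparseAt K δ Θ) : rhoRate Θ ≤ 2 * Real.sqrt δ := by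
  have hc := h.minAsym_pos
  have hC := h.maxAsym_pos
  have hn := h.cast_pos
  have hE := Real.exp_pos Θ.rho
  have hE2 := Real.exp_pos (2 * Θ.rho)
  have h1 : Θ.maxAsym ^ 5 * Real.log n / (Real.exp (2 * Θ.rho) * (n : ℝ) ^ 2 * Θ.minAsym ^ 10)
      ≤ δ := by
    have := h.triangle
    rw [← mul_div_assoc, div_le_div_iff₀ (by positivity) (by positivity)] at this
    rw [div_le_iff₀ (by positivity)]
    linarith
  have h2 : Θ.maxAsym ^ 8 * Real.log n / (Real.exp Θ.rho * n * Θ.minAsym ^ 10) ≤ δ := by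
    have := h.degree
    rw [← mul_div_assoc, div_le_div_iff₀ (by positivity) (by positivity)] at this
    rw [div_le_iff₀ (by positivity)]
    linarith
  unfold rhoRate
  linarith [Real.sqrt_le_sqrt h1, Real.sqrt_le_sqrt h2]

lemma mainRate_sq (h : SparseAt K δ Θ) (M : ℝ) :
    (M * mainRate Θ) ^ 2 = M ^ 2 * (Θ.maxAsym ^ 3 * Real.log n / (n * Θ.minAsym ^ 4)) := by
  have hc := h.minAsym_pos
  have hC := h.maxAsym_pos
  have hl := h.log_pos
  rw [mul_pow, mainRate, Real.sq_sqrt (by positivity)]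

lemma rhoRate_sq_ge (h : SparseAt K δ Θ) (M : ℝ) :
    M ^ 2 * (Θ.maxAsym ^ 5 * Real.log n / (Real.exp Θ.rho ^ 2 * (n : ℝ) ^ 2 * Θ.minAsym ^ 10))
      ≤ (M * rhoRate Θ) ^ 2 ∧
    M ^ 2 * (Θ.maxAsym ^ 8 * Real.log n / (Real.exp Θ.rho * n * Θ.minAsym ^ 10))
      ≤ (M * rhoRate Θ) ^ 2 := by
  have hc := h.minAsym_pos
  have hC := h.maxAsym_pos
  have hl := h.log_pos
  have hE : Real.exp Θ.rho ^ 2 = Real.exp (2 * Θ.rho) := by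
    rw [← Real.exp_nat_mul]; norm_num
  rw [hE, mul_pow]
  have hu : 0 ≤ Θ.maxAsym ^ 5 * Real.log n
    / (Real.exp (2 * Θ.rho) * (n : ℝ) ^ 2 * Θ.minAsym ^ 10) := by positivity
  have hv : 0 ≤ Θ.maxAsym ^ 8 * Real.log n / (Real.exp Θ.rho * n * Θ.minAsym ^ 10) := by
    positivity
  have hu' := Real.sq_sqrt hu
  have hv' := Real.sq_sqrt hv
  have := Real.sqrt_nonneg (Θ.maxAsym ^ 5 * Real.log n
    / (Real.exp (2 * Θ.rho) * (n : ℝ) ^ 2 * Θ.minAsym ^ 10))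
  have := Real.sqrt_nonneg (Θ.maxAsym ^ 8 * Real.log n
    / (Real.exp Θ.rho * n * Θ.minAsym ^ 10))
  constructor <;> refine mul_le_mul_of_nonneg_left ?_ (sq_nonneg M) <;> unfold rhoRate <;> nlinarith

lemma one_le_ratio (h : SparseAt K δ Θ) : 1 ≤ Θ.maxAsym / Θ.minAsym := by
  rw [one_le_div h.minAsym_pos]; exact Θ.minAsym_le_maxAsym h.two_le

end SparseAt
end Sparse

/-! ### Sparse regime: precision of the four types of triple-dyad sum -/

namespace SparseAt

variable {n : ℕ} {Θ : Param n} {K δ : ℝ}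

lemma rhoRate_nonneg (Θ : Param n) : 0 ≤ rhoRate Θ :=
  add_nonneg (Real.sqrt_nonneg _) (Real.sqrt_nonneg _)

lemma mainRate_nonneg (Θ : Param n) : 0 ≤ mainRate Θ := Real.sqrt_nonneg _

lemma eta_le (h : SparseAt K δ Θ) (hδ : 32 * K * (2 * Real.sqrt δ) ≤ 1 / 2) :
    32 * K * rhoRate Θ ≤ 1 / 2 :=
  (mul_le_mul_of_nonneg_left h.rhoRate_le (by linarith [h.one_le])).trans hδ

lemma eps_le (h : SparseAt K δ Θ) (hδ : 32 * K * (2 * Real.sqrt δ) ≤ 1 / 2) :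
    32 * K * mainRate Θ ≤ 1 / 2 :=
  (mul_le_mul_of_nonneg_left h.mainRate_le_rhoRate (by linarith [h.one_le])).trans (h.eta_le hδ)

lemma one_le_four_log (h : SparseAt K δ Θ) : 1 ≤ 4 * Real.log n := by
  linarith [three_quarters_le_log h.size]

lemma resolves_asym_null (h : SparseAt K δ Θ) (hδ : 32 * K * (2 * Real.sqrt δ) ≤ 1 / 2) :
    Resolves Θ (0, 1) (0, 0) Θ.minAsym (Θ.minAsym ^ 2 / (K * Θ.maxAsym ^ 2)) 1
      (32 * K * mainRate Θ) (4 * Real.log n) := by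
  have hc := h.minAsym_pos
  have hC := h.maxAsym_pos
  have hn := h.cast_pos
  have hl := h.log_pos
  have hK := h.one_le
  have hK0 : 0 < K := by linarith
  refine ⟨h.size, hc, by positivity, fun i j hij => ?_, fun i j hij => h.le_p_null hij,
    fun i j _ => Θ.p_le_one _ _ _ _, mul_nonneg (by linarith) (mainRate_nonneg Θ),
    h.eps_le hδ, h.one_le_four_log, ?_, ?_⟩
  · exact (Θ.minAsym_le hij.symm).trans_eq (Θ.p_swap 1 0 j i)
  · rw [h.mainRate_sq]
    have h1 : (32 * K) ^ 2 * (Θ.maxAsym ^ 3 * Real.log n / (n * Θ.minAsym ^ 4))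
        * (n * Θ.minAsym * (Θ.minAsym ^ 2 / (K * Θ.maxAsym ^ 2)))
        = 1024 * (K * (Θ.maxAsym / Θ.minAsym)) * Real.log n := by field_simp; ring
    rw [h1]
    nlinarith [one_le_mul_of_one_le_of_one_le hK h.one_le_ratio]
  · rw [h.mainRate_sq]
    have h1 : (32 * K) ^ 2 * (Θ.maxAsym ^ 3 * Real.log n / (n * Θ.minAsym ^ 4))
        * (n ^ 2 * Θ.minAsym ^ 2 * (Θ.minAsym ^ 2 / (K * Θ.maxAsym ^ 2)))
        = 1024 * (K * (n * Θ.maxAsym)) * Real.log n := by field_simp; ring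
    have h2 : 1 ≤ n * Θ.maxAsym := h.one_le_mul_minAsym.trans
      (mul_le_mul_of_nonneg_left (Θ.minAsym_le_maxAsym h.two_le) hn.le)
    rw [h1]
    nlinarith [one_le_mul_of_one_le_of_one_le hK h2]

lemma resolves_null_asym (h : SparseAt K δ Θ) (hδ : 32 * K * (2 * Real.sqrt δ) ≤ 1 / 2) :
    Resolves Θ (0, 0) (0, 1) (Θ.minAsym ^ 2 / (K * Θ.maxAsym ^ 2)) Θ.minAsym Θ.maxAsym
      (32 * K * mainRate Θ) (4 * Real.log n) := by
  have hc := h.minAsym_pos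
  have hC := h.maxAsym_pos
  have hC1 := Θ.maxAsym_le_one h.two_le
  have hn := h.cast_pos
  have hl := h.log_pos
  have hK := h.one_le
  have hK0 : 0 < K := by linarith
  refine ⟨h.size, by positivity, hc, fun i j hij => h.le_p_null hij, fun i j hij => ?_,
    fun i j hij => ?_, mul_nonneg (by linarith) (mainRate_nonneg Θ),
    h.eps_le hδ, h.one_le_four_log, ?_, ?_⟩
  · exact (Θ.minAsym_le hij.symm).trans_eq (Θ.p_swap 1 0 j i)
  · exact (Θ.p_swap 0 1 i j).trans_le (Θ.le_maxAsym hij.symm)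
  · rw [h.mainRate_sq]
    have h1 : (32 * K) ^ 2 * (Θ.maxAsym ^ 3 * Real.log n / (n * Θ.minAsym ^ 4))
        * (n * (Θ.minAsym ^ 2 / (K * Θ.maxAsym ^ 2)) * Θ.minAsym)
        = 1024 * (K * (Θ.maxAsym / Θ.minAsym)) * Real.log n := by field_simp; ring
    rw [h1]
    nlinarith [one_le_mul_of_one_le_of_one_le hK h.one_le_ratio]
  · rw [h.mainRate_sq]
    -- The lower bound on p⁰⁰ enters squared here, and its K⁻² is cancelled exactly by the K² in ε².
    -- The number 32² = 1024 is 256 · 4, from `triangle` with L = 4 log n.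
    have h1 : (32 * K) ^ 2 * (Θ.maxAsym ^ 3 * Real.log n / (n * Θ.minAsym ^ 4))
        * (n ^ 2 * (Θ.minAsym ^ 2 / (K * Θ.maxAsym ^ 2)) ^ 2 * Θ.minAsym)
        = 1024 * (n * Θ.minAsym / Θ.maxAsym) * Real.log n := by field_simp; ring
    have h2 : 1 ≤ n * Θ.minAsym / Θ.maxAsym := by
      rw [one_le_div hC]; exact hC1.trans h.one_le_mul_minAsym
    rw [h1]
    nlinarith

lemma resolves_mutual_asym (h : SparseAt K δ Θ) (hδ : 32 * K * (2 * Real.sqrt δ) ≤ 1 / 2) :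
    Resolves Θ (1, 1) (1, 0) (Real.exp Θ.rho * Θ.minAsym ^ 2) Θ.minAsym Θ.maxAsym
      (32 * K * rhoRate Θ) (4 * Real.log n) := by
  have hc := h.minAsym_pos
  have hC := h.maxAsym_pos
  have hn := h.cast_pos
  have hl := h.log_pos
  have hK := h.one_le
  have hE := Real.exp_pos Θ.rho
  have hK2 : (1 : ℝ) ≤ K ^ 2 := one_le_pow₀ hK
  refine ⟨h.size, by positivity, hc, fun i j hij => h.le_p_mutual hij,
    fun i j hij => Θ.minAsym_le hij, fun i j hij => Θ.le_maxAsym hij,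
    mul_nonneg (by linarith) (rhoRate_nonneg Θ), h.eta_le hδ, h.one_le_four_log, ?_, ?_⟩
  -- The second summand of `rhoRate`, of order 1/n under the root, pays for the degree condition;
  -- the first, of order 1/n², pays for the triangle condition.
  · refine le_trans ?_ (mul_le_mul_of_nonneg_right (h.rhoRate_sq_ge (32 * K)).2 (by positivity))
    have h1 : (32 * K) ^ 2 * (Θ.maxAsym ^ 8 * Real.log n
        / (Real.exp Θ.rho * n * Θ.minAsym ^ 10))
        * (n * (Real.exp Θ.rho * Θ.minAsym ^ 2) * Θ.minAsym)
        = 1024 * (K ^ 2 * (Θ.maxAsym / Θ.minAsym) ^ 7) * (Θ.maxAsym * Real.log n) := by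
      field_simp; ring
    rw [h1]
    have h2 := one_le_mul_of_one_le_of_one_le hK2 (one_le_pow₀ h.one_le_ratio (n := 7))
    have h3 : 0 < Θ.maxAsym * Real.log n := by positivity
    nlinarith
  · refine le_trans ?_ (mul_le_mul_of_nonneg_right (h.rhoRate_sq_ge (32 * K)).1 (by positivity))
    have h1 : (32 * K) ^ 2 * (Θ.maxAsym ^ 5 * Real.log n
        / (Real.exp Θ.rho ^ 2 * (n : ℝ) ^ 2 * Θ.minAsym ^ 10))
        * (n ^ 2 * (Real.exp Θ.rho * Θ.minAsym ^ 2) ^ 2 * Θ.minAsym)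
        = 1024 * (K ^ 2 * (Θ.maxAsym / Θ.minAsym) ^ 5) * Real.log n := by
      field_simp; ring
    rw [h1]
    nlinarith [one_le_mul_of_one_le_of_one_le hK2 (one_le_pow₀ h.one_le_ratio (n := 5))]

lemma resolves_asym_mutual (h : SparseAt K δ Θ) (hδ : 32 * K * (2 * Real.sqrt δ) ≤ 1 / 2) :
    Resolves Θ (1, 0) (1, 1) Θ.minAsym (Real.exp Θ.rho * Θ.minAsym ^ 2)
      (K * (Real.exp Θ.rho * Θ.maxAsym ^ 2)) (32 * K * rhoRate Θ) (4 * Real.log n) := by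
  have hc := h.minAsym_pos
  have hC := h.maxAsym_pos
  have hn := h.cast_pos
  have hl := h.log_pos
  have hK := h.one_le
  have hE := Real.exp_pos Θ.rho
  have hK2 : (1 : ℝ) ≤ K ^ 2 := one_le_pow₀ hK
  -- With mutual dyads in the middle, this factor is left over in both conditions, next to a power
  -- of C_n/c_n.
  have hinv : 1 ≤ 1 / (Real.exp Θ.rho * Θ.minAsym) := by
    rw [one_le_div (by positivity)]; exact h.exp_rho_mul_minAsym_le
  refine ⟨h.size, hc, by positivity, fun i j hij => Θ.minAsym_le hij,
    fun i j hij => h.le_p_mutual hij, fun i j hij => h.mutual_le i j hij,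
    mul_nonneg (by linarith) (rhoRate_nonneg Θ), h.eta_le hδ, h.one_le_four_log, ?_, ?_⟩
  · refine le_trans ?_ (mul_le_mul_of_nonneg_right (h.rhoRate_sq_ge (32 * K)).2 (by positivity))
    have h1 : (32 * K) ^ 2 * (Θ.maxAsym ^ 8 * Real.log n
        / (Real.exp Θ.rho * n * Θ.minAsym ^ 10))
        * (n * Θ.minAsym * (Real.exp Θ.rho * Θ.minAsym ^ 2))
        = 1024 * (K * ((Θ.maxAsym / Θ.minAsym) ^ 6 * (1 / (Real.exp Θ.rho * Θ.minAsym))))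
          * (K * (Real.exp Θ.rho * Θ.maxAsym ^ 2) * Real.log n) := by
      field_simp; ring
    rw [h1]
    have h2 := one_le_mul_of_one_le_of_one_le hK (one_le_mul_of_one_le_of_one_le
      (one_le_pow₀ h.one_le_ratio (n := 6)) hinv)
    have h3 : 0 < K * (Real.exp Θ.rho * Θ.maxAsym ^ 2) * Real.log n := by positivity
    nlinarith
  · refine le_trans ?_ (mul_le_mul_of_nonneg_right (h.rhoRate_sq_ge (32 * K)).1 (by positivity))
    have h1 : (32 * K) ^ 2 * (Θ.maxAsym ^ 5 * Real.log n
        / (Real.exp Θ.rho ^ 2 * (n : ℝ) ^ 2 * Θ.minAsym ^ 10))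
        * (n ^ 2 * Θ.minAsym ^ 2 * (Real.exp Θ.rho * Θ.minAsym ^ 2))
        = 1024 * (K ^ 2 * ((Θ.maxAsym / Θ.minAsym) ^ 5
          * (1 / (Real.exp Θ.rho * Θ.minAsym)))) * Real.log n := by
      field_simp; ring
    rw [h1]
    nlinarith [one_le_mul_of_one_le_of_one_le hK2 (one_le_mul_of_one_le_of_one_le
      (one_le_pow₀ h.one_le_ratio (n := 5)) hinv)]

end SparseAt

lemma SparseRegime.eventually_sparseAt {K δ : ℝ} (hδ0 : 0 < δ) (hδ1 : δ ≤ 1 / 16)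
    {Θ : ∀ n : ℕ, Param n} (hΘ : ∀ n, (Θ n).Identified) (h : SparseRegime K Θ) :
    ∀ᶠ n in atTop, SparseAt (max K 1) δ (Θ n) := by
  filter_upwards [eventually_ge_atTop 4, h.theta_atBot.eventually_le_atBot 0,
    h.rho_small.bound one_pos, h.mutual_le, h.growth_one.bound hδ0, h.growth_two.bound hδ0]
    with n hn hθ hρ hm h1 h2
  have hc := (Θ n).minAsym_pos (by omega)
  have hC := hc.trans_le ((Θ n).minAsym_le_maxAsym (by omega))
  have hl := three_quarters_le_log hn
  have hn0 : (0 : ℝ) < n := by exact_mod_cast (by omega : 0 < n)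
  refine ⟨hn, le_max_right _ _, hΘ n, hδ0, hδ1, ?_, fun i j hij => ?_, ?_, ?_⟩
  · rw [one_mul, Real.norm_eq_abs, Real.norm_eq_abs, abs_of_nonpos hθ] at hρ
    linarith [le_abs_self (Θ n).rho]
  · exact (hm i j hij).trans (mul_le_mul_of_nonneg_right (le_max_left _ _) (by positivity))
  · rwa [Real.norm_of_nonneg (by positivity), Real.norm_of_nonneg (by positivity)] at h1
  · rwa [Real.norm_of_nonneg (by positivity), Real.norm_of_nonneg (by positivity)] at h2

lemma exists_error_bound_of_sparseRegime (K : ℝ) : ∃ M : ℝ, 0 < M ∧ ∀ Θ : ∀ n : ℕ, Param n,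
    (∀ n, (Θ n).Identified) → SparseRegime K Θ → ∀ᶠ n : ℕ in atTop,
      ∀ (Ω : Type*) [MeasurableSpace Ω] (P : Measure Ω) [IsProbabilityMeasure P]
        (X : Ω → Fin n → Fin n → Fin 2), IsModel (Θ n) P X →
        1 - M / n ≤ P.real {ω | WellDefined (X ω) ∧
          |rhoHat (X ω) - (Θ n).rho| ≤ M * rhoRate (Θ n) ∧
          |thetaHat (X ω) - (Θ n).theta| ≤ M * mainRate (Θ n) ∧
          (∀ i, |alphaHat (X ω) i - (Θ n).alpha i| ≤ M * mainRate (Θ n)) ∧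
          (∀ j, |betaHat (X ω) j - (Θ n).beta j| ≤ M * mainRate (Θ n))} := by
  have hK : 1 ≤ max K 1 := le_max_right _ _
  set κ := max K 1 with hκ
  have hκ0 : 0 < κ := by linarith
  refine ⟨24 * (32 * κ), by positivity, fun Θ hΘ hS => ?_⟩
  -- Chosen so that 32 κ · 2√δ = 1/2, which by `rhoRate_le` keeps both precisions within the range ε
  -- ≤ 1/2.
  set δ : ℝ := (1 / (128 * κ)) ^ 2 with hδ
  have hδ0 : 0 < δ := by positivity
  have hδ1 : δ ≤ 1 / 16 := by
    have h1 : 1 / (128 * κ) ≤ 1 / 4 := one_div_le_one_div_of_le (by norm_num) (by linarith)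
    calc δ ≤ (1 / 4) ^ 2 := pow_le_pow_left₀ (by positivity) h1 2
      _ = 1 / 16 := by norm_num
  have hδK : 32 * κ * (2 * Real.sqrt δ) ≤ 1 / 2 := by
    rw [hδ, Real.sqrt_sq (by positivity)]
    refine le_of_eq ?_
    field_simp; norm_num
  filter_upwards [hS.eventually_sparseAt hδ0 hδ1 hΘ] with n h Ω _ P _ X hX
  have key := hX.estimator_concentration h.identified (h.resolves_asym_null hδK)
    (h.resolves_null_asym hδK) (h.resolves_mutual_asym hδK) (h.resolves_asym_mutual hδK)
  have hn0 := h.cast_pos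
  have hprob : 1 - 24 * (32 * κ) / (n : ℝ) ≤ 1 - 16 / n := by
    gcongr
    linarith
  refine (hprob.trans key).trans (measureReal_mono ?_)
  rintro ω ⟨hwd, hρ, hθ, hα, hβ⟩
  have hrates := mul_le_mul_of_nonneg_left h.mainRate_le_rhoRate (by positivity : 0 ≤ 32 * κ)
  have h0 : 0 ≤ 32 * κ * mainRate (Θ n) := mul_nonneg (by positivity) (SparseAt.mainRate_nonneg _)
  -- The ρ̂ bound 12 η + 12 ε becomes 24 η because `mainRate` is at most `rhoRate`.
  exact ⟨hwd, by linarith, by linarith, fun i => by linarith [hα i], fun j => by linarith [hβ j]⟩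

end P1

theorem theorem1 :
    (∀ C : ℝ, 0 < C → ∃ M : ℝ, 0 < M ∧ ∀ n : ℕ, 1 ≤ n → ∀ Θ : P1.Param n,
      Θ.Identified → ‖Θ‖ ≤ C →
      ∀ (Ω : Type*) [MeasurableSpace Ω] (P : Measure Ω) [IsProbabilityMeasure P]
        (X : Ω → Fin n → Fin n → Fin 2), P1.IsModel Θ P X →
        1 - M / n ≤ P.real {ω | P1.WellDefined (X ω) ∧
          ‖P1.estimator (X ω) - Θ‖ ≤ M * Real.sqrt (Real.log n / n)}) ∧
    (∀ K : ℝ, 0 < K → ∃ M : ℝ, 0 < M ∧ ∀ Θ : ∀ n : ℕ, P1.Param n,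
      (∀ n, (Θ n).Identified) → P1.SparseRegime K Θ →
      ∀ᶠ n : ℕ in atTop,
      ∀ (Ω : Type*) [MeasurableSpace Ω] (P : Measure Ω) [IsProbabilityMeasure P]
        (X : Ω → Fin n → Fin n → Fin 2), P1.IsModel (Θ n) P X →
        1 - M / n ≤ P.real {ω | P1.WellDefined (X ω) ∧
          |P1.rhoHat (X ω) - (Θ n).rho| ≤ M * P1.rhoRate (Θ n) ∧
          |P1.thetaHat (X ω) - (Θ n).theta| ≤ M * P1.mainRate (Θ n) ∧
          (∀ i, |P1.alphaHat (X ω) i - (Θ n).alpha i| ≤ M * P1.mainRate (Θ n)) ∧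
          (∀ j, |P1.betaHat (X ω) j - (Θ n).beta j| ≤ M * P1.mainRate (Θ n))}) :=
  ⟨fun C _ => P1.exists_error_bound_of_norm_le C,
    fun K _ => P1.exists_error_bound_of_sparseRegime K⟩
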